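/- Throughout, $\|\cdot\|$ is the Euclidean norm and $|\cdot|$ the sup-norm on $\mathbb R^m$ and $\mathbb C^m$, $\mathrm{mes}$ is Lebesgue measure, and $\log 0=-\infty$. Proposition. Let $n\ge 2$. There are constants $c_0(n),C(n),H_*(n)>0$, depending only on $n$, such that the following holds for every constant $0<c\le c_0(n)$. Let $0<r_0<1$ and let $f$ be a real-valued real-analytic function on $\{x\in\mathbb R^n:|x|<r_0\}$ which extends analytically to the polydisk $\mathcal P=\{z\in\mathbb C^n:|z|<r_0\}$. Assume that $$f(0)=0,\qquad \nabla f(0)=0,\qquad \mathfrak H(0)\ge\nu_0 I,\qquad 0<\nu_0<1,$$ where $\mathfrak H(0)$ is the Hessian matrix of $f$ at $0$. Let $M(k)=\max_{|\alpha|=k}\sup_{\mathcal P}|\partial^\alpha f|$ and set $$\nu_1=c\,\nu_0\,(1+M(2)+M(3))^{-1},\qquad \rho=r_0\nu_1^{10}$$ (with $\nu_1=0$ if $M(2)$ or $M(3)$ is infinite). Let $x_0\in\mathbb R^n$ with $0<\|x_0\|<\rho$, $E_0=f(x_0)$, $r=\nu_1\|x_0\|$. Then there exists a real-analytic map $x(y,E)\in\mathbb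 R^n$, $(y,E)\in\mathbb R^{n-1}\times\mathbb R$, $|y|<r$, $|E-E_0|<r^2$, such that $$f(x(y,E))=E,\qquad x(0,E_0)=x_0,$$ and such that the following hold. (I) The map $x(y,E)$ extends analytically to $\{(w,E)\in\mathbb C^{n-1}\times\mathbb C:|w|<r,\ |E-E_0|<r^2\}$ and there satisfies $\|x(w,E)-x_0\|<\|x_0\|/2$. (II) For every real $E$ with $|E-E_0|<r^2$, every $h\in\mathbb R^n$ with $0<\|h\|<\rho$, and every $H\ge H_*(n)$, $$\mathrm{mes}\{y\in\mathbb R^{n-1}:|y|<r,\ \log|f(x(y,E)+h)-E|\le H_0H\}\le(\nu_1^{-2}r)^{n-1}\exp\big(-H^{\frac1{n-1}}\big),\qquad H_0=C(n)\log(\|h\|\|x_0\|).$$ (III) For every unit vector $h_0\in\mathbb R^n$, every real $E$ with $|E-E_0|<r^2$, and every $H\ge H_*(n)$, $$\mathrm{mes}\{y\in\mathbb R^{n-1}:|y|<r,\ \log|\langle\nabla f(x(y,E)),h_0\rangle|\le H_1H\}\le(\nu_1^{-2}r)^{n-1}\exp\big(-H^{\frac1{n-1}}\big),\qquad H_1=C(n)\log(\nu_1\|x_0\|).$$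 -/

import Mathlib

noncomputable section

/-- The open cube of all real `x` with sup-norm `|x| < R`. -/
def realCube (n : ℕ) (R : ℝ) : Set (EuclideanSpace ℝ (Fin n)) :=
  {x | ∀ i, |x i| < R}

/-- The open polydisk of all complex `z` with sup-norm `|z| < R`. -/
def polydisk (n : ℕ) (R : ℝ) : Set (EuclideanSpace ℂ (Fin n)) :=
  {z | ∀ i, ‖z i‖ < R}

/-- The inclusion of real `n`-space into complex `n`-space. -/
def toComplexVec {n : ℕ} (x : EuclideanSpace ℝ (Fin n)) : EuclideanSpace ℂ (Fin n) :=
  WithLp.toLp 2 (fun i => (x i : ℂ))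

/-- The Hessian matrix of second partial derivatives of `f` at `x`. -/
def hessian {n : ℕ} (f : EuclideanSpace ℝ (Fin n) → ℝ) (x : EuclideanSpace ℝ (Fin n)) :
    Matrix (Fin n) (Fin n) ℝ :=
  Matrix.of fun i j =>
    iteratedFDeriv ℝ 2 f x ![EuclideanSpace.single i 1, EuclideanSpace.single j 1]

/-- `M(k) = max_{|α| = k} sup_{|z| < R} |∂^α F(z)|`, as an extended nonnegative number. The partial
derivatives of order `k` are listed by the tuples `(i₁, …, iₖ)` of coordinate directions. -/
def derivSup {n : ℕ} (F : EuclideanSpace ℂ (Fin n) → ℂ) (R : ℝ) (k : ℕ) : ENNReal :=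
  ⨆ i : Fin k → Fin n, ⨆ z ∈ polydisk n R,
    ‖iteratedFDeriv ℂ k F z (fun j => EuclideanSpace.single (i j) 1)‖ₑ

/-- `ν₁ = c ν₀ (1 + M(2) + M(3))⁻¹`; the inverse is `0` if `M(2)` or `M(3)` is infinite. -/
def nuOne {n : ℕ} (c ν₀ : ℝ) (F : EuclideanSpace ℂ (Fin n) → ℂ) (R : ℝ) : ℝ :=
  c * ν₀ * ((1 + derivSup F R 2 + derivSup F R 3)⁻¹).toReal

/-- The real box `|y| < r`, `|E - E₀| < r²` (sup-norm on `y`). -/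
def realBox (m : ℕ) (r E₀ : ℝ) : Set ((Fin m → ℝ) × ℝ) :=
  {p | ‖p.1‖ < r ∧ |p.2 - E₀| < r ^ 2}

/-- The complex polydisk `|w| < r`, `|E - E₀| < r²` (sup-norm on `w`). -/
def complexBox (m : ℕ) (r E₀ : ℝ) : Set ((Fin m → ℂ) × ℂ) :=
  {p | ‖p.1‖ < r ∧ ‖p.2 - (E₀ : ℂ)‖ < r ^ 2}

/-- `log |t|` with values in the extended reals, so that `log 0 = -∞`. -/
def logAbs (t : ℝ) : EReal := ENNReal.log (ENNReal.ofReal |t|)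

theorem logAbs_le_iff (t a : ℝ) : logAbs t ≤ (a : EReal) ↔ |t| ≤ Real.exp a := by
  have h : (a : EReal) = ENNReal.log (ENNReal.ofReal (Real.exp a)) := by
    rw [ENNReal.log_ofReal_of_pos (Real.exp_pos a), Real.log_exp]
  rw [logAbs, h, ENNReal.log_le_log_iff, ENNReal.ofReal_le_ofReal_iff (Real.exp_pos a).le]

end

/-! The small-value estimates rest on a Cartan-type principle: a holomorphic function bounded by 1
on a polydisk that exceeds `exp (-μ)` at one real point can be tiny only on a set of exponentially
small measure. In one variable (`volume_small_values_le`), a large set of small values would contain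
well-spaced nodes; interpolation there would make the function small everywhere on the interval.
Slicing and Fubini (`volume_small_values_pi_le`) give the cube, each coordinate multiplying the
exponent by `10 * h`. With `h = H ^ (1 / m)`, `m = n - 1`, the total factor is `10 ^ m * H`.

The level sets come from the gradient. At distance `‖x₀‖` from the minimum the gradient has length
at least `ν₀ / 2 * ‖x₀‖`, while on a patch of size comparable to `r = ν₁ * ‖x₀‖` it varies only by a
small fraction of that. In an orthonormal frame whose vector `b 0` is the normalized gradient, `f =
E` is therefore solved for the normal coordinate by a contraction, over the complex polydisk as well
as over the reals. Uniqueness makes the solution analytic and real at real arguments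
(`LevelPatch.exists_parametrization`).

It remains to find one point of the patch where the function in question is not small
(`LevelPatch.exists_large_value`). Both `x ↦ f (x + h) - f x` and `x ↦ ∂f/∂h₀` are nearly linear
there, with linear parts `A h` and `A · h₀`, where `A` is the Hessian form at the origin; positivity
of `A` makes these functionals large. If such a functional is large on a tangent direction, two
points of the level set on opposite sides see it. If it is large on the normal, a tangent
displacement need not detect it, and the curvature of the level set is used: by convexity of `f` the
second difference of the graph is at least of order `ν₁ ^ 2 * r`
(`LevelPatch.second_difference_ge`), and the functional does not vanish on it. -/

open Metric

/-! ### Cartan estimate for small values of bounded holomorphic functions -/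

/-- Greedy choice from the left: a point near the infimum is taken and an interval of length
slightly more than `a` discarded, which leaves more than `N * a` of measure. Only subadditivity is
used, so the set need not be measurable. -/
theorem exists_spaced_points {a : ℝ} (ha : 0 ≤ a) (N : ℕ) :
    ∀ S : Set ℝ, BddBelow S → ENNReal.ofReal (N * a) < MeasureTheory.volume S →
      ∃ x : ℕ → ℝ, (∀ i ≤ N, x i ∈ S) ∧ ∀ i < N, x i + a ≤ x (i + 1) := by
  induction N with
  | zero =>
    intro S _ hS
    have hne : S.Nonempty := MeasureTheory.nonempty_of_measure_ne_zero (by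
      rw [Nat.cast_zero, zero_mul, ENNReal.ofReal_zero] at hS; exact hS.ne')
    obtain ⟨s, hs⟩ := hne
    exact ⟨fun _ => s, fun _ _ => hs, fun i hi => absurd hi (Nat.not_lt_zero i)⟩
  | succ N ih =>
    intro S hb hS
    have hne : S.Nonempty := MeasureTheory.nonempty_of_measure_ne_zero (pos_of_gt hS).ne'
    obtain ⟨t, ht, htS⟩ : ∃ t : ℝ, ((N + 1 : ℕ) : ℝ) * a < t ∧
        ENNReal.ofReal t < MeasureTheory.volume S := by
      obtain ⟨q, hq1, hq2⟩ := ENNReal.lt_iff_exists_real_btwn.1 hS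
      have : ((N + 1 : ℕ) : ℝ) * a < q := by
        by_contra hcon
        exact absurd hq2.1 (not_lt.2 (ENNReal.ofReal_le_ofReal (not_lt.1 hcon)))
      exact ⟨q, this, hq2.2⟩
    -- The slack `θ` is needed because the infimum need not be attained; it is paid for by the
    -- strict inequality on the measure.
    set θ := t - ((N + 1 : ℕ) : ℝ) * a with hθ
    have hθ0 : 0 < θ := sub_pos.2 ht
    obtain ⟨s, hsS, hs⟩ := exists_lt_of_csInf_lt hne (lt_add_of_pos_right (sInf S) hθ0)
    set S' := S ∩ Set.Ici (sInf S + θ + a) with hS'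
    have hcov : S ⊆ Set.Ico (sInf S) (sInf S + θ + a) ∪ S' := by
      intro y hy
      by_cases h : y < sInf S + θ + a
      · exact Or.inl ⟨csInf_le hb hy, h⟩
      · exact Or.inr ⟨hy, not_lt.1 h⟩
    have hm : ENNReal.ofReal (N * a) < MeasureTheory.volume S' := by
      by_contra hcon
      have h1 : MeasureTheory.volume S ≤ ENNReal.ofReal (θ + a) + ENNReal.ofReal (N * a) := by
        refine (MeasureTheory.measure_mono hcov).trans
          ((MeasureTheory.measure_union_le _ _).trans (add_le_add ?_ (not_lt.1 hcon)))
        rw [Real.volume_Ico]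
        exact ENNReal.ofReal_le_ofReal (by linarith)
      rw [← ENNReal.ofReal_add (by positivity) (by positivity)] at h1
      refine absurd (htS.trans_le h1) (not_lt.2 (ENNReal.ofReal_le_ofReal ?_))
      rw [hθ]; push_cast; linarith
    obtain ⟨x, hx1, hx2⟩ := ih S' (hb.mono Set.inter_subset_left) hm
    refine ⟨fun i => Nat.casesOn i s x, ?_, ?_⟩
    · rintro (_ | i) hi
      · exact hsS
      · exact (hx1 i (by omega)).1
    · rintro (_ | i) hi
      · have := (hx1 0 (Nat.zero_le _)).2
        simp only [Set.mem_Ici] at this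
        change s + a ≤ x 0
        linarith
      · exact hx2 i (by omega)

theorem le_sub_of_spaced {a : ℝ} {N : ℕ} {x : ℕ → ℝ} (hx : ∀ i < N, x i + a ≤ x (i + 1))
    (i k : ℕ) (h : i + k ≤ N) : k * a ≤ x (i + k) - x i := by
  induction k with
  | zero => simp
  | succ k ih =>
    have h1 := ih (by omega)
    have h2 := hx (i + k) (by omega)
    rw [← add_assoc]
    push_cast
    linarith

/-- The divided-difference quotient `dslope` of a bounded holomorphic function is bounded. -/
theorem norm_dslope_le_of_ball {g : ℂ → ℂ} {R r B : ℝ} {x z : ℂ} (hrR : r < R)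
    (hg : DifferentiableOn ℂ g (Metric.ball 0 R)) (hB : ∀ z ∈ Metric.ball (0 : ℂ) R, ‖g z‖ ≤ B)
    (hx : ‖x‖ ≤ r) (hz : z ∈ Metric.ball (0 : ℂ) R) :
    ‖dslope g x z‖ ≤ 2 * B / (R - r) := by
  have hxR : x ∈ Metric.ball (0 : ℂ) R := mem_ball_zero_iff.2 (hx.trans_lt hrR)
  have hB0 : 0 ≤ B := (norm_nonneg _).trans (hB x hxR)
  have hdiff : ∀ w ∈ Metric.ball (0 : ℂ) R, ‖g w - g x‖ ≤ 2 * B := fun w hw =>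
    (norm_sub_le _ _).trans (by linarith [hB w hw, hB x hxR])
  have hsub : Metric.ball x (R - r) ⊆ Metric.ball 0 R :=
    Metric.ball_subset_ball' (by rw [dist_zero_right]; linarith)
  -- Near `x` the Schwarz lemma applies; farther away the denominator of the difference quotient is
  -- at least `R - r`.
  by_cases hzx : z ∈ Metric.ball x (R - r)
  · refine Complex.norm_dslope_le_div_of_mapsTo_ball (hg.mono hsub) (fun w hw => ?_) hzx
    rw [mem_closedBall_iff_norm]
    exact hdiff w (hsub hw)
  · rw [mem_ball_iff_norm, not_lt] at hzx
    have hne : z ≠ x := by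
      rintro rfl
      rw [sub_self, norm_zero] at hzx
      linarith
    rw [dslope_of_ne _ hne, slope_def_field, norm_div]
    exact div_le_div₀ (by positivity) (hdiff z hz) (by linarith) hzx

open Polynomial in
/-- Newton interpolation with a remainder that is holomorphic and bounded. -/
theorem exists_interpolation_remainder {g : ℂ → ℂ} {R r B : ℝ} (hrR : r < R)
    (hg : DifferentiableOn ℂ g (Metric.ball 0 R)) (hB : ∀ z ∈ Metric.ball (0 : ℂ) R, ‖g z‖ ≤ B)
    (x : ℕ → ℂ) (k : ℕ) (hx : ∀ i < k, ‖x i‖ ≤ r) :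
    ∃ (P : ℂ[X]) (q : ℂ → ℂ), P.degree < k ∧ DifferentiableOn ℂ q (Metric.ball 0 R) ∧
      (∀ z ∈ Metric.ball (0 : ℂ) R, ‖q z‖ ≤ (2 / (R - r)) ^ k * B) ∧
      ∀ z, g z = P.eval z + q z * ∏ i ∈ Finset.range k, (z - x i) := by
  induction k with
  | zero => exact ⟨0, g, by simp, hg, by simpa using hB, by simp⟩
  | succ k ih =>
    obtain ⟨P, q, hP, hq, hqB, hgP⟩ := ih fun i hi => hx i (by omega)
    have hxk := hx k (Nat.lt_succ_self k)
    -- Newton's form: the old remainder at the new node is the next coefficient, and its divided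
    -- difference is the new remainder, at the cost of a factor `2 / (R - r)`.
    refine ⟨P + C (q (x k)) * ∏ i ∈ Finset.range k, (X - C (x i)), dslope q (x k), ?_, ?_, ?_, ?_⟩
    · refine (degree_add_le _ _).trans_lt (max_lt (hP.trans (by exact_mod_cast Nat.lt_succ_self k)) ?_)
      refine (degree_mul_le _ _).trans_lt ?_
      rw [degree_prod]
      simp only [degree_X_sub_C, Finset.sum_const, Finset.card_range, nsmul_eq_mul, mul_one]
      refine (add_le_add_left degree_C_le _).trans_lt ?_
      rw [zero_add]
      exact_mod_cast Nat.lt_succ_self k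
    · exact (Complex.differentiableOn_dslope (Metric.isOpen_ball.mem_nhds
        (mem_ball_zero_iff.2 (hxk.trans_lt hrR)))).2 hq
    · intro z hz
      refine (norm_dslope_le_of_ball hrR hq hqB hxk hz).trans_eq ?_
      rw [pow_succ]; ring
    · intro z
      have h := sub_smul_dslope q (x k) z
      rw [smul_eq_mul] at h
      rw [hgP z, eval_add, eval_mul, eval_C, eval_prod, Finset.prod_range_succ]
      simp only [eval_sub, eval_X, eval_C]
      linear_combination (-∏ i ∈ Finset.range k, (z - x i)) * h

/-- Size of the Lagrange basis for spaced nodes. -/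
theorem norm_eval_basis_le {a L : ℝ} (ha : 0 < a) {D : ℕ} {x : ℕ → ℂ} {y : ℂ}
    (hx : ∀ i ≤ D, ∀ j ≤ D, |(i : ℝ) - j| * a ≤ ‖x i - x j‖) (hy : ∀ i ≤ D, ‖y - x i‖ ≤ L)
    {i : ℕ} (hi : i ≤ D) :
    ‖(Lagrange.basis (Finset.range (D + 1)) x i).eval y‖ ≤
      (L / a) ^ D * ((i.factorial : ℝ)⁻¹ * ((D - i).factorial : ℝ)⁻¹) := by
  have key : ∏ j ∈ (Finset.range (D + 1)).erase i, |(i : ℝ) - j| =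
      (i.factorial : ℝ) * ((D - i).factorial : ℝ) := by
    have hsplit : (Finset.range (D + 1)).erase i = Finset.range i ∪ Finset.Ico (i + 1) (D + 1) := by
      ext j
      simp only [Finset.mem_erase, Finset.mem_range, Finset.mem_union, Finset.mem_Ico]
      omega
    rw [hsplit, Finset.prod_union (by
      rw [Finset.disjoint_left]; intro j; simp only [Finset.mem_range, Finset.mem_Ico]; omega)]
    congr 1
    · rw [← Finset.prod_range_reflect, ← Finset.prod_range_add_one_eq_factorial]
      push_cast
      refine Finset.prod_congr rfl fun j hj => ?_
      have hj := Finset.mem_range.1 hj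
      have h1 : i - 1 - j + (j + 1) = i := by omega
      have h2 : ((i - 1 - j : ℕ) : ℝ) + (j + 1) = i := by exact_mod_cast h1
      rw [abs_of_nonneg] <;> linarith [(Nat.cast_nonneg j : (0 : ℝ) ≤ j)]
    · rw [Finset.prod_Ico_eq_prod_range, ← Finset.prod_range_add_one_eq_factorial]
      push_cast
      refine Finset.prod_congr rfl fun j _ => ?_
      rw [abs_of_nonpos] <;> linarith [(Nat.cast_nonneg j : (0 : ℝ) ≤ j)]
  have hcard : ((Finset.range (D + 1)).erase i).card = D := by
    rw [Finset.card_erase_of_mem (Finset.mem_range.2 (by omega)), Finset.card_range]; rfl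
  rw [Lagrange.basis, Polynomial.eval_prod, norm_prod]
  calc _ ≤ ∏ j ∈ (Finset.range (D + 1)).erase i, (L / a) * |(i : ℝ) - j|⁻¹ := by
        refine Finset.prod_le_prod (fun _ _ => norm_nonneg _) fun j hj => ?_
        have hj' := Finset.mem_erase.1 hj
        have hjD : j ≤ D := by have := Finset.mem_range.1 hj'.2; omega
        have hpos : 0 < |(i : ℝ) - j| := abs_pos.2 (sub_ne_zero.2 (by exact_mod_cast hj'.1.symm))
        rw [Lagrange.basisDivisor]
        simp only [Polynomial.eval_mul, Polynomial.eval_C, Polynomial.eval_sub, Polynomial.eval_X,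
          norm_mul, norm_inv]
        calc ‖x i - x j‖⁻¹ * ‖y - x j‖ ≤ (|(i : ℝ) - j| * a)⁻¹ * L := by
              refine mul_le_mul (inv_anti₀ (by positivity) (hx i hi j hjD)) (hy j hjD)
                (norm_nonneg _) (by positivity)
          _ = _ := by rw [mul_inv]; ring
    _ = _ := by
        rw [Finset.prod_mul_distrib, Finset.prod_const, hcard, Finset.prod_inv_distrib, key, mul_inv]

/-- The total of the Lagrange weights. Its `D!` in the denominator compensates the `D ^ D` produced
by nodes spaced at distance proportional to `1 / D`. -/
theorem sum_inv_factorial_mul (D : ℕ) :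
    ∑ i ∈ Finset.range (D + 1), ((i.factorial : ℝ)⁻¹ * ((D - i).factorial : ℝ)⁻¹) =
      2 ^ D / D.factorial := by
  have h : (2 : ℝ) ^ D = ∑ i ∈ Finset.range (D + 1), (D.choose i : ℝ) := by
    exact_mod_cast (Nat.sum_range_choose D).symm
  rw [h, Finset.sum_div]
  refine Finset.sum_congr rfl fun i hi => ?_
  rw [Nat.cast_choose ℝ (by have := Finset.mem_range.1 hi; omega : i ≤ D)]
  field_simp

/-- One-dimensional Cartan estimate on a real interval. -/
theorem volume_small_values_le {g : ℂ → ℂ} {r h μ y₀ : ℝ} (hr : 0 < r) (hh : 1 ≤ h) (hμ : 1 ≤ μ)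
    (hg : DifferentiableOn ℂ g (Metric.ball 0 (13 * r)))
    (hB : ∀ z ∈ Metric.ball (0 : ℂ) (13 * r), ‖g z‖ ≤ 1) (hy₀ : |y₀| < r)
    (hgy : Real.exp (-μ) < ‖g y₀‖) :
    MeasureTheory.volume {y : ℝ | |y| < r ∧ ‖g y‖ ≤ Real.exp (-(10 * h * μ))} ≤
      ENNReal.ofReal (r * Real.exp (-h)) := by
  by_contra hcon
  rw [not_le] at hcon
  set S := {y : ℝ | |y| < r ∧ ‖g y‖ ≤ Real.exp (-(10 * h * μ))} with hS
  -- The degree is matched to `μ` so that the remainder, of order `3⁻¹ ^ (D + 1)`, falls below `exp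
  -- (-(μ + 1))`; the spacing `a` is the largest that the assumed measure provides for `D + 1`
  -- nodes.
  set D := ⌈μ⌉₊ with hD
  have hDμ : μ ≤ D := Nat.le_ceil μ
  have hDμ' : (D : ℝ) < μ + 1 := Nat.ceil_lt_add_one (by linarith)
  have hD0 : (0 : ℝ) < D := by linarith
  set a := r * Real.exp (-h) / D with ha
  have ha0 : 0 < a := by positivity
  have hDa : D * a = r * Real.exp (-h) := by rw [ha]; field_simp
  obtain ⟨x, hxS, hx⟩ := exists_spaced_points ha0.le D S
    ⟨-r, fun y hy => (abs_lt.1 hy.1).1.le⟩ (by rwa [hDa])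
  have hdist : ∀ i ≤ D, ∀ j ≤ D, |(i : ℝ) - j| * a ≤ ‖((x i : ℝ) : ℂ) - (x j : ℝ)‖ := by
    have hle : ∀ i j, i ≤ j → j ≤ D → |(i : ℝ) - j| * a ≤ ‖((x i : ℝ) : ℂ) - (x j : ℝ)‖ := by
      intro i j hij hj
      obtain ⟨k, rfl⟩ := Nat.exists_eq_add_of_le hij
      have h1 := le_sub_of_spaced hx i k hj
      rw [← Complex.ofReal_sub, Complex.norm_real, Real.norm_eq_abs, abs_sub_comm (x i)]
      push_cast
      rw [show (i : ℝ) - (i + k) = -k by ring, abs_neg, Nat.abs_cast]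
      exact h1.trans (le_abs_self _)
    intro i hi j hj
    rcases le_total i j with hij | hij
    · exact hle i j hij hj
    · rw [abs_sub_comm, norm_sub_rev]
      exact hle j i hij hi
  have hxr : ∀ i ≤ D, ‖((x i : ℝ) : ℂ)‖ ≤ r := fun i hi => by
    rw [Complex.norm_real]; exact (hxS i hi).1.le
  have hyx : ∀ i ≤ D, ‖(y₀ : ℂ) - (x i : ℝ)‖ ≤ 2 * r := fun i hi => by
    refine (norm_sub_le _ _).trans ?_
    have := hxr i hi
    rw [Complex.norm_real, Real.norm_eq_abs]
    linarith
  obtain ⟨P, q, hP, -, hqB, hgP⟩ := exists_interpolation_remainder (r := r) (by linarith) hg hB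
    (fun i => ((x i : ℝ) : ℂ)) (D + 1) (fun i hi => hxr i (by omega))
  have hinj : Set.InjOn (fun i => ((x i : ℝ) : ℂ)) (Finset.range (D + 1) : Set ℕ) := by
    intro i hi j hj hij
    simp only [Finset.coe_range, Set.mem_Iio] at hi hj
    have h1 := hdist i (by omega) j (by omega)
    simp only at hij
    rw [hij, sub_self, norm_zero] at h1
    have h2 : |(i : ℝ) - j| = 0 := le_antisymm (nonpos_of_mul_nonpos_left h1 ha0) (abs_nonneg _)
    exact_mod_cast sub_eq_zero.1 (abs_eq_zero.1 h2)
  have hPint : P = Lagrange.interpolate (Finset.range (D + 1)) (fun i => ((x i : ℝ) : ℂ))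
      (fun i => g (x i : ℝ)) := by
    refine Lagrange.eq_interpolate_of_eval_eq _ hinj (by rwa [Finset.card_range]) fun i hi => ?_
    have h1 := hgP (x i : ℝ)
    rw [Finset.prod_eq_zero hi (sub_self _), mul_zero, add_zero] at h1
    exact h1.symm
  have hPy : ‖P.eval (y₀ : ℂ)‖ ≤
      Real.exp (-(10 * h * μ)) * ((2 * r / a) ^ D * (2 ^ D / D.factorial)) := by
    rw [hPint, Lagrange.interpolate_apply, Polynomial.eval_finsetSum, ← sum_inv_factorial_mul,
      Finset.mul_sum, Finset.mul_sum]
    refine norm_sum_le_of_le _ fun i hi => ?_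
    have hi' : i ≤ D := by have := Finset.mem_range.1 hi; omega
    rw [Polynomial.eval_mul, Polynomial.eval_C, norm_mul]
    exact mul_le_mul (hxS i hi').2 (norm_eval_basis_le ha0 hdist hyx hi') (norm_nonneg _)
      (Real.exp_pos _).le
  have h4 : (4 : ℝ) ≤ Real.exp 2 := by
    have h1 := Real.exp_one_gt_d9
    have h2 : Real.exp 2 = Real.exp 1 * Real.exp 1 := by rw [← Real.exp_add]; norm_num
    rw [h2]; nlinarith
  have hfac : (2 * r / a) ^ D * (2 ^ D / D.factorial) ≤ Real.exp (D * (h + 3)) := by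
    have h1 : 2 * r / a = 2 * Real.exp h * D := by
      rw [ha, Real.exp_neg]; field_simp
    have h2 := Real.pow_div_factorial_le_exp (D : ℝ) hD0.le D
    calc _ = (4 * Real.exp h) ^ D * ((D : ℝ) ^ D / D.factorial) := by
          rw [h1, mul_pow, mul_pow, mul_pow, show (4 : ℝ) = 2 * 2 by norm_num, mul_pow]; ring
      _ ≤ (Real.exp 2 * Real.exp h) ^ D * Real.exp D := by gcongr
      _ = _ := by
          rw [← Real.exp_add, ← Real.exp_nat_mul, ← Real.exp_add]; ring_nf
  have hrem : ‖q y₀ * ∏ i ∈ Finset.range (D + 1), ((y₀ : ℂ) - (x i : ℝ))‖ ≤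
      Real.exp (-(μ + 1)) := by
    have hy : (y₀ : ℂ) ∈ Metric.ball (0 : ℂ) (13 * r) := by
      rw [mem_ball_zero_iff, Complex.norm_real, Real.norm_eq_abs]; linarith
    have h1 : ‖∏ i ∈ Finset.range (D + 1), ((y₀ : ℂ) - (x i : ℝ))‖ ≤ (2 * r) ^ (D + 1) := by
      rw [norm_prod]
      refine (Finset.prod_le_prod (fun _ _ => norm_nonneg _) fun i hi =>
        hyx i (by have := Finset.mem_range.1 hi; omega)).trans_eq ?_
      rw [Finset.prod_const, Finset.card_range]
    rw [norm_mul]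
    calc _ ≤ (2 / (13 * r - r)) ^ (D + 1) * 1 * (2 * r) ^ (D + 1) :=
          mul_le_mul (hqB _ hy) h1 (norm_nonneg _)
            (mul_nonneg (pow_nonneg (div_nonneg zero_le_two (by linarith)) _) zero_le_one)
      -- The radius `13 * r` is chosen for this: nodes in radius `r` leave a margin `12 * r`, and `2
      -- / (12 * r) * (2 * r) = 1 / 3 < exp (-1)`.
      _ = (3⁻¹ : ℝ) ^ (D + 1) := by
          rw [mul_one, ← mul_pow]; congr 1
          rw [show 13 * r - r = 12 * r by ring]; field_simp; norm_num
      _ ≤ (Real.exp (-1)) ^ (D + 1) := by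
          gcongr
          rw [Real.exp_neg]
          exact inv_anti₀ (Real.exp_pos 1) (by linarith [Real.exp_one_lt_d9])
      _ ≤ _ := by
          rw [← Real.exp_nat_mul]
          refine Real.exp_le_exp.2 ?_
          push_cast; linarith
  have hfin : Real.exp (-μ) < Real.exp (-(μ + 1)) + Real.exp (-(μ + 1)) := by
    refine hgy.trans_le ?_
    rw [hgP y₀]
    refine (norm_add_le _ _).trans (add_le_add ?_ hrem)
    refine hPy.trans ((mul_le_mul_of_nonneg_left hfac (Real.exp_pos _).le).trans ?_)
    rw [← Real.exp_add]
    refine Real.exp_le_exp.2 ?_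
    -- The factor 10 comes from here: `2 * μ * (h + 3) + μ + 1 ≤ 10 * h * μ` when `h, μ ≥ 1`.
    have h1 : (D : ℝ) * (h + 3) ≤ (2 * μ) * (h + 3) := by gcongr; linarith
    nlinarith [mul_nonneg (sub_nonneg.2 hμ) (sub_nonneg.2 hh)]
  rw [neg_add, Real.exp_add, Real.exp_neg 1] at hfin
  have h2 := Real.exp_one_gt_d9
  have h3 : (Real.exp 1)⁻¹ < 2⁻¹ := inv_strictAnti₀ (by norm_num) (by linarith)
  nlinarith [Real.exp_pos (-μ)]

/-- Cartan estimate on a real cube, by induction on the dimension. -/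
theorem volume_small_values_pi_le {r h : ℝ} (hr : 0 < r) (hh : 1 ≤ h) (d : ℕ) :
    ∀ (φ : (Fin d → ℂ) → ℂ) (μ : ℝ), 1 ≤ μ →
      DifferentiableOn ℂ φ (Metric.ball 0 (13 * r)) →
      (∀ w ∈ Metric.ball (0 : Fin d → ℂ) (13 * r), ‖φ w‖ ≤ 1) →
      (∃ y : Fin d → ℝ, ‖y‖ < r ∧ Real.exp (-μ) < ‖φ fun i => (y i : ℂ)‖) →
      MeasureTheory.volume {y : Fin d → ℝ | ‖y‖ < r ∧
        ‖φ fun i => (y i : ℂ)‖ ≤ Real.exp (-((10 * h) ^ d * μ))} ≤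
      ENNReal.ofReal (d * (2 * r) ^ d * Real.exp (-h)) := by
  induction d with
  | zero =>
    rintro φ μ - - - ⟨y, -, hy⟩
    have hemp : {y : Fin 0 → ℝ | ‖y‖ < r ∧
        ‖φ fun i => (y i : ℂ)‖ ≤ Real.exp (-((10 * h) ^ 0 * μ))} = ∅ := by
      ext z
      simp only [Set.mem_ofPred_eq, Set.mem_empty_iff_false, iff_false, not_and, not_le]
      intro _
      rwa [pow_zero, one_mul, Subsingleton.elim z y]
    rw [hemp, MeasureTheory.measure_empty]
    exact zero_le
  | succ d ih =>
    rintro φ μ hμ hφ hB ⟨y₀, hy₀, hφy⟩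
    have hcons : ∀ (a : ℂ) (b : Fin d → ℂ), a ∈ Metric.ball (0 : ℂ) (13 * r) →
        b ∈ Metric.ball (0 : Fin d → ℂ) (13 * r) →
        (Fin.cons a b : Fin (d + 1) → ℂ) ∈ Metric.ball (0 : Fin (d + 1) → ℂ) (13 * r) := by
      intro a b ha hb
      rw [mem_ball_zero_iff] at ha hb ⊢
      rw [pi_norm_lt_iff (by positivity)] at hb ⊢
      exact Fin.cases ha hb
    have hcr : ∀ (a : ℝ) (b : Fin d → ℝ), (fun i => (((Fin.cons a b : Fin (d + 1) → ℝ) i : ℝ) : ℂ))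
        = (Fin.cons (a : ℂ) (fun i => (b i : ℂ)) : Fin (d + 1) → ℂ) := by
      intro a b; funext i; refine Fin.cases ?_ (fun j => ?_) i <;> simp
    have hcast : ∀ b : Fin d → ℝ, ‖b‖ < r →
        (fun i => (b i : ℂ)) ∈ Metric.ball (0 : Fin d → ℂ) (13 * r) := by
      intro b hb
      rw [pi_norm_lt_iff hr] at hb
      rw [mem_ball_zero_iff, pi_norm_lt_iff (by positivity)]
      intro i; rw [Complex.norm_real]; linarith [hb i]
    have hdcons : ∀ b : Fin d → ℂ, Differentiable ℂ
        (fun a : ℂ => (Fin.cons a b : Fin (d + 1) → ℂ)) := by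
      intro b
      rw [differentiable_pi]
      intro i; refine Fin.cases ?_ (fun j => ?_) i
      · simp
      · simp
    have hdcons' : ∀ a : ℂ, Differentiable ℂ
        (fun b : Fin d → ℂ => (Fin.cons a b : Fin (d+1) → ℂ)) := by
      intro a
      rw [differentiable_pi]
      intro i; refine Fin.cases ?_ (fun j => ?_) i
      · simp
      · simpa using differentiable_apply j
    set a₀ := y₀ 0
    set b₀ : Fin d → ℝ := fun i => y₀ i.succ
    have hy0cons : y₀ = Fin.cons a₀ b₀ := by
      funext i; refine Fin.cases ?_ (fun j => ?_) i <;> rfl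
    have hy₀' := (pi_norm_lt_iff hr).1 hy₀
    have ha₀ : |a₀| < r := hy₀' 0
    have hb₀ : ‖b₀‖ < r := (pi_norm_lt_iff hr).2 fun i => hy₀' i.succ
    set T := {y : Fin (d + 1) → ℝ | ‖y‖ < r ∧
        ‖φ fun i => (y i : ℂ)‖ ≤ Real.exp (-((10 * h) ^ (d + 1) * μ))} with hT
    -- The exceptional first coordinates, measured along the line through the good point `y₀`. For
    -- `a ∉ N` the slice inherits `b₀` as its good point, with `10 * h * μ` in place of `μ`.
    set N := {a : ℝ | |a| < r ∧ ‖φ (Fin.cons (a : ℂ) fun i => (b₀ i : ℂ))‖ ≤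
      Real.exp (-(10 * h * μ))} with hN
    have hNvol : MeasureTheory.volume N ≤ ENNReal.ofReal (r * Real.exp (-h)) := by
      refine volume_small_values_le (g := fun z => φ (Fin.cons z fun i => (b₀ i : ℂ))) hr hh hμ
        (hφ.comp (hdcons _).differentiableOn fun a ha => hcons _ _ ha (hcast b₀ hb₀))
        (fun z hz => hB _ (hcons _ _ hz (hcast b₀ hb₀))) ha₀ ?_
      rw [← hcr, ← hy0cons]; exact hφy
    have hslice : ∀ a : ℝ, |a| < r → a ∉ N →
        MeasureTheory.volume {b : Fin d → ℝ | Fin.cons a b ∈ T} ≤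
          ENNReal.ofReal (d * (2 * r) ^ d * Real.exp (-h)) := by
      intro a ha haN
      have haB : (a : ℂ) ∈ Metric.ball (0 : ℂ) (13 * r) := by
        rw [mem_ball_zero_iff, Complex.norm_real, Real.norm_eq_abs]; linarith
      have hμ' : 1 ≤ 10 * h * μ := by nlinarith
      refine (MeasureTheory.measure_mono ?_).trans (ih (fun w => φ (Fin.cons (a : ℂ) w))
        (10 * h * μ) hμ' (hφ.comp (hdcons' _).differentiableOn fun b hb => hcons _ _ haB hb)
        (fun w hw => hB _ (hcons _ _ haB hw)) ⟨b₀, hb₀, ?_⟩)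
      · intro b hb
        obtain ⟨hb1, hb2⟩ := hb
        rw [hcr] at hb2
        refine ⟨(pi_norm_lt_iff hr).2 fun i => (pi_norm_lt_iff hr).1 hb1 i.succ, hb2.trans_eq ?_⟩
        ring_nf
      · by_contra hc
        exact haN ⟨ha, not_lt.1 hc⟩
    have hTm : MeasurableSet T := by
      have hU : IsOpen {y : Fin (d + 1) → ℝ | ‖y‖ < r} := isOpen_lt continuous_norm continuous_const
      have hcont : ContinuousOn (fun y : Fin (d + 1) → ℝ => ‖φ fun i => (y i : ℂ)‖)
          {y | ‖y‖ < r} := by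
        refine (hφ.continuousOn.comp (f := fun (y : Fin (d + 1) → ℝ) i => (y i : ℂ))
          (by fun_prop) fun y hy => ?_).norm
        have hy := (pi_norm_lt_iff hr).1 hy
        rw [mem_ball_zero_iff, pi_norm_lt_iff (by positivity)]
        intro i; rw [Complex.norm_real]; linarith [hy i]
      -- Continuity is known only inside the cube, so `T` is presented as the cube minus a
      -- relatively open subset.
      have hT' : T = {y | ‖y‖ < r} \ ({y | ‖y‖ < r} ∩
          (fun y : Fin (d + 1) → ℝ => ‖φ fun i => (y i : ℂ)‖) ⁻¹'
            Set.Ioi (Real.exp (-((10 * h) ^ (d + 1) * μ)))) := by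
        ext y
        simp only [hT, Set.mem_ofPred_eq, Set.mem_sdiff, Set.mem_inter_iff, Set.mem_preimage,
          Set.mem_Ioi, not_and, not_lt]
        tauto
      rw [hT']
      exact hU.measurableSet.diff (hcont.isOpen_inter_preimage hU isOpen_Ioi).measurableSet
    set e := (MeasurableEquiv.piFinSuccAbove (fun _ : Fin (d + 1) => ℝ) 0).symm with he
    have hpres : MeasureTheory.MeasurePreserving e
        (MeasureTheory.volume.prod MeasureTheory.volume) MeasureTheory.volume :=
      (MeasureTheory.volume_preserving_piFinSuccAbove (fun _ : Fin (d + 1) => ℝ) 0).symm _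
    have hecons : ∀ p : ℝ × (Fin d → ℝ), e p = Fin.cons p.1 p.2 := fun p => by
      simp [he, MeasurableEquiv.piFinSuccAbove, Fin.insertNthEquiv]
    rw [← hpres.measure_preimage hTm.nullMeasurableSet]
    have hsubset : e ⁻¹' T ⊆ (N ×ˢ {b : Fin d → ℝ | ‖b‖ < r}) ∪
        (e ⁻¹' T ∩ ((Set.Ioo (-r) r \ N) ×ˢ Set.univ)) := by
      rintro ⟨a, b⟩ hab
      have hab' := hab
      rw [Set.mem_preimage, hecons] at hab'
      have h1 := (pi_norm_lt_iff hr).1 hab'.1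
      by_cases haN : a ∈ N
      · exact Or.inl ⟨haN, (pi_norm_lt_iff hr).2 fun i => h1 i.succ⟩
      · exact Or.inr ⟨hab, ⟨abs_lt.1 (h1 0), haN⟩, trivial⟩
    have hNm : MeasurableSet N := by
      have hcont : ContinuousOn (fun a : ℝ => ‖φ (Fin.cons (a : ℂ) fun i => (b₀ i : ℂ))‖)
          (Set.Ioo (-r) r) := by
        refine (hφ.continuousOn.comp
          ((hdcons _).continuous.comp Complex.continuous_ofReal).continuousOn fun a ha => ?_).norm
        refine hcons _ _ ?_ (hcast b₀ hb₀)
        rw [mem_ball_zero_iff, Complex.norm_real, Real.norm_eq_abs]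
        linarith [abs_lt.2 ha]
      have hN' : N = Set.Ioo (-r) r \ (Set.Ioo (-r) r ∩
          (fun a : ℝ => ‖φ (Fin.cons (a : ℂ) fun i => (b₀ i : ℂ))‖) ⁻¹'
            Set.Ioi (Real.exp (-(10 * h * μ)))) := by
        ext y
        simp only [hN, Set.mem_ofPred_eq, Set.mem_sdiff, Set.mem_inter_iff, Set.mem_preimage,
          Set.mem_Ioi, not_and, not_lt, abs_lt, Set.mem_Ioo]
        tauto
      rw [hN']
      exact measurableSet_Ioo.diff (hcont.isOpen_inter_preimage isOpen_Ioo isOpen_Ioi).measurableSet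
    have hcube : MeasureTheory.volume {b : Fin d → ℝ | ‖b‖ < r} = ENNReal.ofReal ((2 * r) ^ d) := by
      have : {b : Fin d → ℝ | ‖b‖ < r} = Metric.ball 0 r := by ext; simp
      rw [this, Real.volume_pi_ball _ hr, Fintype.card_fin]
    refine (MeasureTheory.measure_mono hsubset).trans ((MeasureTheory.measure_union_le _ _).trans ?_)
    have hp1 : (MeasureTheory.volume.prod MeasureTheory.volume) (N ×ˢ {b : Fin d → ℝ | ‖b‖ < r}) ≤
        ENNReal.ofReal ((2 * r) ^ (d + 1) * Real.exp (-h)) := by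
      rw [MeasureTheory.Measure.prod_prod, hcube]
      refine (mul_le_mul_left hNvol _).trans ?_
      rw [← ENNReal.ofReal_mul (by positivity)]
      refine ENNReal.ofReal_le_ofReal ?_
      have : 0 ≤ r * Real.exp (-h) * (2 * r) ^ d := by positivity
      rw [pow_succ]; linarith
    have hp2 : (MeasureTheory.volume.prod MeasureTheory.volume)
        (e ⁻¹' T ∩ ((Set.Ioo (-r) r \ N) ×ˢ (Set.univ : Set (Fin d → ℝ)))) ≤
        ENNReal.ofReal (d * (2 * r) ^ (d + 1) * Real.exp (-h)) := by
      rw [MeasureTheory.Measure.prod_apply ((e.measurable hTm).inter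
        ((measurableSet_Ioo.diff hNm).prod MeasurableSet.univ))]
      calc _ ≤ ∫⁻ a in Set.Ioo (-r) r, ENNReal.ofReal (d * (2 * r) ^ d * Real.exp (-h)) := by
            rw [← MeasureTheory.lintegral_indicator measurableSet_Ioo]
            refine MeasureTheory.lintegral_mono fun a => ?_
            by_cases ha : a ∈ Set.Ioo (-r) r ∧ a ∉ N
            · rw [Set.indicator_of_mem ha.1]
              refine (MeasureTheory.measure_mono fun b hb => ?_).trans
                (hslice a (abs_lt.2 ha.1) ha.2)
              have := hb.1
              rwa [Set.mem_preimage, hecons] at this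
            · have : Prod.mk a ⁻¹' (e ⁻¹' T ∩ ((Set.Ioo (-r) r \ N) ×ˢ
                  (Set.univ : Set (Fin d → ℝ)))) = ∅ := by
                ext b
                simp only [Set.mem_preimage, Set.mem_inter_iff, Set.mem_prod, Set.mem_sdiff,
                  Set.mem_univ, and_true, Set.mem_empty_iff_false, iff_false, not_and]
                exact fun _ h1 h2 => ha ⟨h1, h2⟩
              rw [this, MeasureTheory.measure_empty]
              exact zero_le
        _ = _ := by
            rw [MeasureTheory.setLIntegral_const, Real.volume_Ioo,
              ← ENNReal.ofReal_mul (by positivity)]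
            congr 1; ring
    refine (add_le_add hp1 hp2).trans ?_
    rw [← ENNReal.ofReal_add (by positivity) (by positivity)]
    refine ENNReal.ofReal_le_ofReal (le_of_eq ?_)
    push_cast; ring

/-! ### Complexification and operator bounds for derivatives -/

/-- The inclusion of real `n`-space into complex `n`-space as a real linear isometry. -/
def toComplexVecIsometry (n : ℕ) : EuclideanSpace ℝ (Fin n) →ₗᵢ[ℝ] EuclideanSpace ℂ (Fin n) where
  toFun := toComplexVec
  map_add' x y := by ext i; simp [toComplexVec]
  map_smul' a x := by ext i; simp [toComplexVec]
  norm_map' x := by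
    change ‖toComplexVec x‖ = ‖x‖
    rw [EuclideanSpace.norm_eq, EuclideanSpace.norm_eq]
    simp [toComplexVec]

@[simp] theorem toComplexVecIsometry_apply {n : ℕ} (x : EuclideanSpace ℝ (Fin n)) :
    toComplexVecIsometry n x = toComplexVec x := rfl

@[simp] theorem norm_toComplexVec {n : ℕ} (x : EuclideanSpace ℝ (Fin n)) :
    ‖toComplexVec x‖ = ‖x‖ := (toComplexVecIsometry n).norm_map x

theorem toComplexVec_add {n : ℕ} (x y : EuclideanSpace ℝ (Fin n)) :
    toComplexVec (x + y) = toComplexVec x + toComplexVec y := (toComplexVecIsometry n).map_add x y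

theorem toComplexVec_sub {n : ℕ} (x y : EuclideanSpace ℝ (Fin n)) :
    toComplexVec (x - y) = toComplexVec x - toComplexVec y := (toComplexVecIsometry n).map_sub x y

theorem toComplexVec_smul {n : ℕ} (a : ℝ) (x : EuclideanSpace ℝ (Fin n)) :
    toComplexVec (a • x) = (a : ℂ) • toComplexVec x := by ext i; simp [toComplexVec]

theorem toComplexVec_sum {n : ℕ} {ι : Type*} (s : Finset ι) (x : ι → EuclideanSpace ℝ (Fin n)) :
    toComplexVec (∑ i ∈ s, x i) = ∑ i ∈ s, toComplexVec (x i) :=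
  map_sum (toComplexVecIsometry n) x s

@[simp] theorem toComplexVec_zero {n : ℕ} : toComplexVec (0 : EuclideanSpace ℝ (Fin n)) = 0 :=
  (toComplexVecIsometry n).map_zero

theorem toComplexVec_single {n : ℕ} (i : Fin n) :
    toComplexVec (EuclideanSpace.single i (1 : ℝ)) = EuclideanSpace.single i (1 : ℂ) := by
  ext j
  by_cases h : j = i <;> simp [toComplexVec, h]

theorem ball_subset_polydisk (n : ℕ) (R : ℝ) : ball 0 R ⊆ polydisk n R := fun z hz i =>
  (PiLp.norm_apply_le z i).trans_lt (mem_ball_zero_iff.1 hz)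

theorem ball_subset_realCube (n : ℕ) (R : ℝ) : ball 0 R ⊆ realCube n R := fun z hz i =>
  (PiLp.norm_apply_le z i).trans_lt (mem_ball_zero_iff.1 hz)

theorem EuclideanSpace.sum_smul_single {𝕜 : Type*} [RCLike 𝕜] {n : ℕ}
    (x : EuclideanSpace 𝕜 (Fin n)) : ∑ i, x i • EuclideanSpace.single i (1 : 𝕜) = x := by
  ext j
  simp [Finset.sum_apply, Pi.single_apply]

/-- Each coordinate is bounded by the Euclidean norm, so passing from basis vectors to the operator
norm costs a factor `n`. Iteration turns the partial-derivative suprema into operator bounds with `n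
^ 2` and `n ^ 3`. -/
theorem opNorm_le_of_single {n : ℕ} {G : Type*} [NormedAddCommGroup G] [NormedSpace ℂ G]
    (T : EuclideanSpace ℂ (Fin n) →L[ℂ] G) {M : ℝ} (hM : 0 ≤ M)
    (h : ∀ i, ‖T (EuclideanSpace.single i 1)‖ ≤ M) : ‖T‖ ≤ n * M := by
  refine T.opNorm_le_bound (by positivity) fun x => ?_
  conv_lhs => rw [← EuclideanSpace.sum_smul_single x, map_sum]
  refine (norm_sum_le_of_le _ fun i _ => ?_ : _ ≤ ∑ _i : Fin n, M * ‖x‖).trans_eq ?_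
  · rw [map_smul, norm_smul, mul_comm]
    exact mul_le_mul (h i) (PiLp.norm_apply_le x i) (norm_nonneg _) hM
  · rw [Finset.sum_const, Finset.card_univ, Fintype.card_fin, nsmul_eq_mul]; ring

theorem norm_iteratedFDeriv_le_derivSup {n : ℕ} {F : EuclideanSpace ℂ (Fin n) → ℂ} {R : ℝ} {k : ℕ}
    (hfin : derivSup F R k ≠ ⊤) {z : EuclideanSpace ℂ (Fin n)} (hz : z ∈ polydisk n R)
    (i : Fin k → Fin n) :
    ‖iteratedFDeriv ℂ k F z fun j => EuclideanSpace.single (i j) 1‖ ≤ (derivSup F R k).toReal := by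
  have h : ‖iteratedFDeriv ℂ k F z fun j => EuclideanSpace.single (i j) 1‖ₑ ≤ derivSup F R k :=
    le_iSup_of_le i (le_iSup₂_of_le z hz le_rfl)
  rw [← toReal_enorm]
  exact ENNReal.toReal_mono hfin h

theorem norm_fderiv_fderiv_le {n : ℕ} {F : EuclideanSpace ℂ (Fin n) → ℂ} {R : ℝ}
    (hfin : derivSup F R 2 ≠ ⊤) {z : EuclideanSpace ℂ (Fin n)} (hz : z ∈ polydisk n R) :
    ‖fderiv ℂ (fderiv ℂ F) z‖ ≤ n * (n * (derivSup F R 2).toReal) := by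
  refine opNorm_le_of_single _ (by positivity) fun i =>
    opNorm_le_of_single _ ENNReal.toReal_nonneg fun j => ?_
  have h := norm_iteratedFDeriv_le_derivSup hfin hz ![i, j]
  rwa [iteratedFDeriv_two_apply] at h

set_option maxSynthPendingDepth 3 in
theorem norm_fderiv_fderiv_fderiv_le {n : ℕ} {F : EuclideanSpace ℂ (Fin n) → ℂ} {R : ℝ}
    (hfin : derivSup F R 3 ≠ ⊤) {z : EuclideanSpace ℂ (Fin n)} (hz : z ∈ polydisk n R) :
    ‖fderiv ℂ (fderiv ℂ (fderiv ℂ F)) z‖ ≤ n * (n * (n * (derivSup F R 3).toReal)) := by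
  refine opNorm_le_of_single _ (by positivity) fun i =>
    opNorm_le_of_single _ (by positivity) fun j =>
      opNorm_le_of_single _ ENNReal.toReal_nonneg fun k => ?_
  have h := norm_iteratedFDeriv_le_derivSup hfin hz ![i, j, k]
  rwa [iteratedFDeriv_succ_apply_right, iteratedFDeriv_two_apply] at h

/-- First-order Taylor estimate for a function with Lipschitz derivative. -/
theorem norm_sub_sub_fderiv_le {𝕜 E G : Type*} [RCLike 𝕜] [NormedAddCommGroup E] [NormedSpace 𝕜 E]
    [NormedSpace ℝ E] [NormedAddCommGroup G] [NormedSpace 𝕜 G] {F : E → G} {R K : ℝ} (hK : 0 ≤ K)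
    (hF : ∀ z ∈ ball (0 : E) R, DifferentiableAt 𝕜 F z)
    (hlip : ∀ z ∈ ball (0 : E) R, ∀ w ∈ ball (0 : E) R,
      ‖fderiv 𝕜 F z - fderiv 𝕜 F w‖ ≤ K * ‖z - w‖)
    {b x y : E} {ℓ : ℝ} (hb : b ∈ ball (0 : E) R) (hx : x ∈ ball (0 : E) R)
    (hy : y ∈ ball (0 : E) R) (hxb : ‖x - b‖ ≤ ℓ) (hyb : ‖y - b‖ ≤ ℓ) :
    ‖F y - F x - fderiv 𝕜 F b (y - x)‖ ≤ K * ℓ * ‖y - x‖ := by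
  have hconv : Convex ℝ (ball (0 : E) R ∩ closedBall b ℓ) :=
    (convex_ball _ _).inter (convex_closedBall _ _)
  refine hconv.norm_image_sub_le_of_norm_fderiv_le' (𝕜 := 𝕜) (fun z hz => hF z hz.1) (fun z hz => ?_)
    ⟨hx, mem_closedBall_iff_norm.2 hxb⟩ ⟨hy, mem_closedBall_iff_norm.2 hyb⟩
  exact (hlip z hz.1 b hb).trans
    (mul_le_mul_of_nonneg_left (mem_closedBall_iff_norm.1 hz.2) hK)

/-! ### Quantitative data at the minimum -/

/-- Quantitative data of a nondegenerate minimum at the origin: `F` is the holomorphic extension of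
`f`, `K` bounds the second and third derivatives, `A` is the Hessian form of `f` at the origin. -/
structure NondegMin {n : ℕ} (f : EuclideanSpace ℝ (Fin n) → ℝ) (F : EuclideanSpace ℂ (Fin n) → ℂ)
    (A : EuclideanSpace ℝ (Fin n) →L[ℝ] EuclideanSpace ℝ (Fin n) →L[ℝ] ℝ) (r₀ ν₀ K : ℝ) : Prop where
  analytic : AnalyticOnNhd ℂ F (ball 0 r₀)
  diff : ∀ x ∈ ball (0 : EuclideanSpace ℝ (Fin n)) r₀, DifferentiableAt ℝ f x
  extends_real : ∀ x ∈ ball (0 : EuclideanSpace ℝ (Fin n)) r₀, F (toComplexVec x) = f x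
  fderiv_extends : ∀ x ∈ ball (0 : EuclideanSpace ℝ (Fin n)) r₀, ∀ u,
    fderiv ℂ F (toComplexVec x) (toComplexVec u) = fderiv ℝ f x u
  lip : ∀ z ∈ ball (0 : EuclideanSpace ℂ (Fin n)) r₀, ∀ w ∈ ball (0 : EuclideanSpace ℂ (Fin n)) r₀,
    ‖fderiv ℂ F z - fderiv ℂ F w‖ ≤ K * ‖z - w‖
  lip_real : ∀ x ∈ ball (0 : EuclideanSpace ℝ (Fin n)) r₀,
    ∀ y ∈ ball (0 : EuclideanSpace ℝ (Fin n)) r₀, ‖fderiv ℝ f x - fderiv ℝ f y‖ ≤ K * ‖x - y‖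
  hess_approx : ∀ R < r₀, ∀ x y, ‖x‖ ≤ R → ‖y‖ ≤ R →
    ‖fderiv ℝ f x - fderiv ℝ f y - A (x - y)‖ ≤ K * R * ‖x - y‖
  hess_pos : ∀ v, ν₀ * ‖v‖ ^ 2 ≤ A v v
  map_zero : f 0 = 0
  fderiv_zero : fderiv ℝ f 0 = 0
  fderiv_complex_zero : fderiv ℂ F 0 = 0

/-- Both sides are derivatives of the restriction of `F` to real points, so they agree by uniqueness
of the derivative. Real estimates can thus be read off from complex ones. -/
theorem fderiv_toComplexVec {n : ℕ} {f : EuclideanSpace ℝ (Fin n) → ℝ}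
    {F : EuclideanSpace ℂ (Fin n) → ℂ} {r₀ : ℝ} (hF : AnalyticOnNhd ℂ F (ball 0 r₀))
    (hf : ∀ x ∈ ball (0 : EuclideanSpace ℝ (Fin n)) r₀, DifferentiableAt ℝ f x)
    (hfF : ∀ x ∈ ball (0 : EuclideanSpace ℝ (Fin n)) r₀, F (toComplexVec x) = f x)
    {x : EuclideanSpace ℝ (Fin n)} (hx : x ∈ ball (0 : EuclideanSpace ℝ (Fin n)) r₀)
    (u : EuclideanSpace ℝ (Fin n)) :
    fderiv ℂ F (toComplexVec x) (toComplexVec u) = fderiv ℝ f x u := by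
  have hxC : toComplexVec x ∈ ball (0 : EuclideanSpace ℂ (Fin n)) r₀ := by
    rw [mem_ball_zero_iff, norm_toComplexVec]; exact mem_ball_zero_iff.1 hx
  have h1 : HasFDerivAt (fun y => F (toComplexVec y))
      (((fderiv ℂ F (toComplexVec x)).restrictScalars ℝ).comp
        (toComplexVecIsometry n).toContinuousLinearMap) x :=
    HasFDerivAt.comp x ((hF _ hxC).differentiableAt.hasFDerivAt.restrictScalars ℝ)
      (toComplexVecIsometry n).toContinuousLinearMap.hasFDerivAt
  have h2 : HasFDerivAt (fun y => ((f y : ℝ) : ℂ)) (Complex.ofRealCLM.comp (fderiv ℝ f x)) x :=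
    Complex.ofRealCLM.hasFDerivAt.comp x (hf x hx).hasFDerivAt
  have h3 : (fun y => F (toComplexVec y)) =ᶠ[nhds x] fun y => ((f y : ℝ) : ℂ) :=
    Filter.eventuallyEq_of_mem (isOpen_ball.mem_nhds hx) hfF
  exact DFunLike.congr_fun ((h1.congr_of_eventuallyEq h3.symm).unique h2) u

theorem fderiv_fderiv_toComplexVec {n : ℕ} {f : EuclideanSpace ℝ (Fin n) → ℝ}
    {F : EuclideanSpace ℂ (Fin n) → ℂ} {r₀ : ℝ} (hr₀ : 0 < r₀)
    (hF : AnalyticOnNhd ℂ F (ball 0 r₀)) (hf : AnalyticOnNhd ℝ f (ball 0 r₀))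
    (hfF : ∀ x ∈ ball (0 : EuclideanSpace ℝ (Fin n)) r₀, F (toComplexVec x) = f x)
    (v u : EuclideanSpace ℝ (Fin n)) :
    fderiv ℂ (fderiv ℂ F) 0 (toComplexVec v) (toComplexVec u) = fderiv ℝ (fderiv ℝ f) 0 v u := by
  have h0 := mem_ball_self (x := (0 : EuclideanSpace ℝ (Fin n))) hr₀
  have h1 : HasFDerivAt (fun y => fderiv ℂ F (toComplexVec y))
      (((fderiv ℂ (fderiv ℂ F) (toComplexVec 0)).restrictScalars ℝ).comp
        (toComplexVecIsometry n).toContinuousLinearMap) 0 := by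
    refine HasFDerivAt.comp (0 : EuclideanSpace ℝ (Fin n)) (HasFDerivAt.restrictScalars ℝ ?_)
      (toComplexVecIsometry n).toContinuousLinearMap.hasFDerivAt
    change HasFDerivAt _ _ (toComplexVec 0)
    rw [toComplexVec_zero]
    exact (hF 0 (mem_ball_self hr₀)).fderiv.differentiableAt.hasFDerivAt
  have h1' := ((ContinuousLinearMap.apply ℂ ℂ (toComplexVec u)).restrictScalars ℝ).hasFDerivAt.comp
    (0 : EuclideanSpace ℝ (Fin n)) h1
  have h2 : HasFDerivAt (fun y => ((fderiv ℝ f y u : ℝ) : ℂ)) (Complex.ofRealCLM.comp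
      ((ContinuousLinearMap.apply ℝ ℝ u).comp (fderiv ℝ (fderiv ℝ f) 0))) 0 :=
    Complex.ofRealCLM.hasFDerivAt.comp _ ((ContinuousLinearMap.apply ℝ ℝ u).hasFDerivAt.comp
      (0 : EuclideanSpace ℝ (Fin n)) (hf 0 h0).fderiv.differentiableAt.hasFDerivAt)
  have h3 : (fun y => fderiv ℂ F (toComplexVec y) (toComplexVec u)) =ᶠ[nhds 0]
      fun y => ((fderiv ℝ f y u : ℝ) : ℂ) :=
    Filter.eventuallyEq_of_mem (isOpen_ball.mem_nhds h0) fun y hy =>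
      fderiv_toComplexVec hF (fun x hx => (hf x hx).differentiableAt) hfF hy u
  have h4 := DFunLike.congr_fun ((h1'.congr_of_eventuallyEq h3.symm).unique h2) v
  simpa using h4

theorem hessian_form_ge {n : ℕ} {f : EuclideanSpace ℝ (Fin n) → ℝ} {ν₀ : ℝ}
    (h : (hessian f 0 - ν₀ • (1 : Matrix (Fin n) (Fin n) ℝ)).PosSemidef)
    (v : EuclideanSpace ℝ (Fin n)) : ν₀ * ‖v‖ ^ 2 ≤ fderiv ℝ (fderiv ℝ f) 0 v v := by
  have h1 := h.dotProduct_mulVec_nonneg (fun i => v i)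
  have h2 : fderiv ℝ (fderiv ℝ f) 0 v v = ∑ i, ∑ j, v i * (hessian f 0 i j * v j) := by
    conv_lhs => rw [← EuclideanSpace.sum_smul_single v]
    simp only [map_sum, map_smul, sum_apply, smul_apply,
      smul_eq_mul, hessian, Matrix.of_apply, iteratedFDeriv_two_apply, Matrix.cons_val_zero,
      Matrix.cons_val_one, Finset.mul_sum]
    rw [Finset.sum_comm]
    refine Finset.sum_congr rfl fun i _ => Finset.sum_congr rfl fun j _ => ?_
    ring
  rw [Matrix.sub_mulVec, dotProduct_sub, Matrix.smul_mulVec, Matrix.one_mulVec, dotProduct_smul] at h1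
  have h3 : (fun i => v i) ⬝ᵥ (fun i => v i) = ‖v‖ ^ 2 := by
    rw [EuclideanSpace.norm_sq_eq]
    simp [dotProduct, sq]
  have h4 : (fun i => v i) ⬝ᵥ (hessian f 0).mulVec (fun i => v i) =
      ∑ i, ∑ j, v i * (hessian f 0 i j * v j) := by
    simp only [dotProduct, Matrix.mulVec, Finset.mul_sum]
  simp only [star_trivial, smul_eq_mul] at h1
  rw [h3, h4, ← h2] at h1
  linarith

-- All bounds are mean value inequalities for `F` on the complex ball, restricted to real vectors.
-- The factor `n ^ 3` in `K` covers the second and the third derivatives at once.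
set_option maxSynthPendingDepth 3 in
theorem nondegMin_of_derivSup {n : ℕ} (hn : 1 ≤ n) {f : EuclideanSpace ℝ (Fin n) → ℝ}
    {F : EuclideanSpace ℂ (Fin n) → ℂ} {r₀ ν₀ K : ℝ} (hr₀ : 0 < r₀)
    (hf : AnalyticOnNhd ℝ f (realCube n r₀)) (hF : AnalyticOnNhd ℂ F (polydisk n r₀))
    (hfF : ∀ x ∈ realCube n r₀, F (toComplexVec x) = (f x : ℂ))
    (hf0 : f 0 = 0) (hg0 : gradient f 0 = 0)
    (hH : (hessian f 0 - ν₀ • (1 : Matrix (Fin n) (Fin n) ℝ)).PosSemidef)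
    (h2 : derivSup F r₀ 2 ≠ ⊤) (h3 : derivSup F r₀ 3 ≠ ⊤)
    (hK : K = n ^ 3 * (1 + (derivSup F r₀ 2).toReal + (derivSup F r₀ 3).toReal)) :
    NondegMin f F (fderiv ℝ (fderiv ℝ f) 0) r₀ ν₀ K := by
  have hFb : AnalyticOnNhd ℂ F (ball 0 r₀) := hF.mono (ball_subset_polydisk n r₀)
  have hfb : AnalyticOnNhd ℝ f (ball 0 r₀) := hf.mono (ball_subset_realCube n r₀)
  have hfFb : ∀ x ∈ ball (0 : EuclideanSpace ℝ (Fin n)) r₀, F (toComplexVec x) = f x :=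
    fun x hx => hfF x (ball_subset_realCube n r₀ hx)
  have hdf : ∀ x ∈ ball (0 : EuclideanSpace ℝ (Fin n)) r₀, DifferentiableAt ℝ f x :=
    fun x hx => (hfb x hx).differentiableAt
  have hrel : ∀ x ∈ ball (0 : EuclideanSpace ℝ (Fin n)) r₀, ∀ u,
      fderiv ℂ F (toComplexVec x) (toComplexVec u) = fderiv ℝ f x u :=
    fun x hx u => fderiv_toComplexVec hFb hdf hfFb hx u
  have hball : ∀ x ∈ ball (0 : EuclideanSpace ℝ (Fin n)) r₀,
      toComplexVec x ∈ ball (0 : EuclideanSpace ℂ (Fin n)) r₀ := fun x hx => by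
    rw [mem_ball_zero_iff, norm_toComplexVec]; exact mem_ball_zero_iff.1 hx
  have hn1 : (1 : ℝ) ≤ n := by exact_mod_cast hn
  have hn2 : (n : ℝ) * n ≤ n ^ 3 := by nlinarith [mul_nonneg (sub_nonneg.2 hn1) (sq_nonneg (n : ℝ))]
  have hM2 : (0 : ℝ) ≤ (derivSup F r₀ 2).toReal := ENNReal.toReal_nonneg
  have hM3 : (0 : ℝ) ≤ (derivSup F r₀ 3).toReal := ENNReal.toReal_nonneg
  have hK0 : 0 ≤ K := by rw [hK]; positivity
  have hn3 : (0 : ℝ) ≤ n ^ 3 := by positivity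
  have hK2 : n * (n * (derivSup F r₀ 2).toReal) ≤ K := by rw [hK]; nlinarith
  have hK3 : n * (n * (n * (derivSup F r₀ 3).toReal)) ≤ K := by rw [hK]; nlinarith
  have hdd : ∀ z ∈ ball (0 : EuclideanSpace ℂ (Fin n)) r₀, DifferentiableAt ℂ (fderiv ℂ F) z :=
    fun z hz => (hFb z hz).fderiv.differentiableAt
  have hlip : ∀ z ∈ ball (0 : EuclideanSpace ℂ (Fin n)) r₀,
      ∀ w ∈ ball (0 : EuclideanSpace ℂ (Fin n)) r₀,
      ‖fderiv ℂ F z - fderiv ℂ F w‖ ≤ K * ‖z - w‖ := fun z hz w hw =>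
    (convex_ball _ _).norm_image_sub_le_of_norm_fderiv_le (𝕜 := ℂ) hdd
      (fun x hx => (norm_fderiv_fderiv_le h2 (ball_subset_polydisk n r₀ hx)).trans hK2) hw hz
  have hfd0 : fderiv ℝ f 0 = 0 := by rw [← toDual_gradient, hg0, map_zero]
  refine ⟨hFb, hdf, hfFb, hrel, hlip, ?_, ?_, hessian_form_ge hH, hf0, hfd0, ?_⟩
  · intro x hx y hy
    refine ContinuousLinearMap.opNorm_le_bound _ (by positivity) fun u => ?_
    have h := (fderiv ℂ F (toComplexVec x) - fderiv ℂ F (toComplexVec y)).le_of_opNorm_le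
      (hlip _ (hball x hx) _ (hball y hy)) (toComplexVec u)
    rw [sub_apply, hrel x hx, hrel y hy, ← toComplexVec_sub, norm_toComplexVec,
      norm_toComplexVec, ← Complex.ofReal_sub, Complex.norm_real] at h
    exact h
  · intro R hR x y hx hy
    have hR0 : 0 ≤ R := (norm_nonneg x).trans hx
    have hddd : ∀ z ∈ ball (0 : EuclideanSpace ℂ (Fin n)) r₀,
        DifferentiableAt ℂ (fderiv ℂ (fderiv ℂ F)) z :=
      fun z hz => (hFb z hz).fderiv.fderiv.differentiableAt
    have hsub : closedBall (0 : EuclideanSpace ℂ (Fin n)) R ⊆ ball 0 r₀ := closedBall_subset_ball hR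
    have h4 : ∀ z ∈ closedBall (0 : EuclideanSpace ℂ (Fin n)) R,
        ‖fderiv ℂ (fderiv ℂ F) z - fderiv ℂ (fderiv ℂ F) 0‖ ≤ K * R := by
      intro z hz
      have := (convex_ball (0 : EuclideanSpace ℂ (Fin n)) r₀).norm_image_sub_le_of_norm_fderiv_le
        (𝕜 := ℂ) hddd (fun x hx => (norm_fderiv_fderiv_fderiv_le h3
          (ball_subset_polydisk n r₀ hx)).trans hK3) (mem_ball_self hr₀) (hsub hz)
      rw [sub_zero] at this
      exact this.trans (mul_le_mul_of_nonneg_left (mem_closedBall_zero_iff.1 hz) hK0)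
    -- The second derivative differs from its value at the origin by at most `K * R` on this ball,
    -- so the gradient is linear up to that relative error.
    have h5 := (convex_closedBall (0 : EuclideanSpace ℂ (Fin n)) R).norm_image_sub_le_of_norm_fderiv_le'
      (𝕜 := ℂ) (fun z hz => hdd z (hsub hz)) h4
      (x := toComplexVec y) (y := toComplexVec x)
      (by rwa [mem_closedBall_zero_iff, norm_toComplexVec])
      (by rwa [mem_closedBall_zero_iff, norm_toComplexVec])
    refine ContinuousLinearMap.opNorm_le_bound _ (by positivity) fun u => ?_
    have h := ContinuousLinearMap.le_of_opNorm_le _ h5 (toComplexVec u)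
    rw [sub_apply, sub_apply,
      hrel x (mem_ball_zero_iff.2 (hx.trans_lt hR)), hrel y (mem_ball_zero_iff.2 (hy.trans_lt hR)),
      ← toComplexVec_sub, fderiv_fderiv_toComplexVec hr₀ hFb hfb hfFb, norm_toComplexVec,
      norm_toComplexVec, ← Complex.ofReal_sub, ← Complex.ofReal_sub, Complex.norm_real] at h
    exact h
  -- Real coordinate vectors span the complex space, so vanishing of the real gradient suffices.
  · ext z
    rw [← EuclideanSpace.sum_smul_single z, map_sum]
    refine Finset.sum_eq_zero fun i _ => ?_
    rw [map_smul, ← toComplexVec_single, ← toComplexVec_zero, hrel 0 (mem_ball_self hr₀), hfd0]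
    simp

/-! ### Solving an equation by contraction, with analytic dependence -/

/-- Newton iteration: a function close to `t ↦ g₀ * t` has a unique zero near the origin. -/
theorem exists_unique_zero_of_near_linear {𝕜 : Type*} [RCLike 𝕜] {g : 𝕜 → 𝕜} {g₀ r : ℝ}
    (hg₀ : 0 < g₀) (hr : 0 < r)
    (hlip : ∀ s t : 𝕜, ‖s‖ ≤ r → ‖t‖ ≤ r → ‖g s - g t - (g₀ : 𝕜) * (s - t)‖ ≤ g₀ / 4 * ‖s - t‖)
    (h0 : ‖g 0‖ ≤ g₀ * r / 4) :
    ∃ t, ‖t‖ ≤ r / 2 ∧ g t = 0 ∧ ∀ s, ‖s‖ ≤ r → g s = 0 → s = t := by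
  have hg₀' : (g₀ : 𝕜) ≠ 0 := by exact_mod_cast hg₀.ne'
  have hng : ‖(g₀ : 𝕜)‖ = g₀ := by rw [RCLike.norm_ofReal, abs_of_pos hg₀]
  -- Newton's map with frozen slope contracts by 1/4 and keeps the ball of radius `r / 2`, since `r
  -- / 8 + r / 4 ≤ r / 2`. A general scalar field lets the same argument serve real and complex
  -- roots.
  set Ψ : 𝕜 → 𝕜 := fun t => t - g t / g₀ with hΨ
  have hcon : ∀ s t : 𝕜, ‖s‖ ≤ r → ‖t‖ ≤ r → ‖Ψ s - Ψ t‖ ≤ 1 / 4 * ‖s - t‖ := by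
    intro s t hs ht
    have h1 : Ψ s - Ψ t = -(g s - g t - (g₀ : 𝕜) * (s - t)) / g₀ := by
      simp only [hΨ]; field_simp; ring
    rw [h1, norm_div, norm_neg, hng, div_le_iff₀ hg₀]
    linarith [hlip s t hs ht]
  have hmaps : Set.MapsTo Ψ (closedBall 0 (r / 2)) (closedBall 0 (r / 2)) := by
    intro t ht
    rw [mem_closedBall_zero_iff] at ht ⊢
    have h1 := hcon t 0 (by linarith) (by rw [norm_zero]; exact hr.le)
    have h2 : ‖Ψ 0‖ ≤ r / 4 := by
      simp only [hΨ, zero_sub, norm_neg, norm_div, hng]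
      rw [div_le_iff₀ hg₀]; linarith
    rw [sub_zero] at h1
    have h3 := norm_sub_norm_le (Ψ t) (Ψ 0)
    linarith
  have hcontr : ContractingWith (1 / 4) (hmaps.restrict Ψ _ _) := by
    refine ⟨by norm_num, LipschitzWith.of_dist_le_mul fun s t => ?_⟩
    have hs := mem_closedBall_zero_iff.1 s.2
    have ht := mem_closedBall_zero_iff.1 t.2
    rw [Subtype.dist_eq, Subtype.dist_eq, dist_eq_norm, dist_eq_norm]
    simpa using hcon s t (by linarith) (by linarith)
  obtain ⟨t, ht, hfix, -⟩ := hcontr.exists_fixedPoint' isClosed_closedBall.isComplete hmaps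
    (mem_closedBall_self (by positivity)) (edist_ne_top _ _)
  have ht' := mem_closedBall_zero_iff.1 ht
  have hgt : g t = 0 := by
    have h1 : t - g t / g₀ = t := hfix
    rw [sub_eq_self, div_eq_zero_iff] at h1
    exact h1.resolve_right hg₀'
  refine ⟨t, ht', hgt, fun s hs hgs => ?_⟩
  have h1 := hlip s t hs (by linarith)
  rw [hgs, hgt, sub_self, zero_sub, norm_neg, norm_mul, hng] at h1
  have h2 : ‖s - t‖ ≤ 0 := by nlinarith [norm_nonneg (s - t)]
  exact sub_eq_zero.1 (norm_le_zero_iff.1 h2)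

theorem isInvertible_of_apply_one_ne_zero {L : ℂ →L[ℂ] ℂ} (h : L 1 ≠ 0) : L.IsInvertible := by
  refine ⟨ContinuousLinearEquiv.unitsEquivAut ℂ (Units.mk0 (L 1) h), ?_⟩
  ext
  simp

/-- A locally unique solution of an analytic equation with nonvanishing derivative is analytic. -/
theorem analyticAt_of_unique_solution {P : Type*} [NormedAddCommGroup P] [NormedSpace ℂ P]
    [CompleteSpace P] {Φ : P × ℂ → ℂ} {T : P → ℂ} {U : Set P} {V : Set ℂ} {p : P}
    (hU : U ∈ nhds p) (hV : V ∈ nhds (T p)) (hΦ : AnalyticAt ℂ Φ (p, T p)) (hzero : Φ (p, T p) = 0)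
    (hder : fderiv ℂ Φ (p, T p) (0, 1) ≠ 0)
    (huniq : ∀ q ∈ U, ∀ t ∈ V, Φ (q, t) = 0 → t = T q) : AnalyticAt ℂ T p := by
  -- The top regularity exponent in `WithTop ℕ∞` means analytic, so the implicit function obtained
  -- here is itself analytic.
  have cdf : ContDiffAt ℂ ⊤ Φ (p, T p) := hΦ.contDiffAt
  have hne : (⊤ : WithTop ℕ∞) ≠ 0 := by simp
  have hinv : (fderiv ℂ Φ (p, T p) ∘L .inr ℂ P ℂ).IsInvertible :=
    isInvertible_of_apply_one_ne_zero (by simpa using hder)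
  have h1 := cdf.contDiffAt_implicitFunction hne hinv
  have h2 := cdf.eventually_apply_implicitFunction hne hinv
  have h3 : Filter.Tendsto (cdf.implicitFunction hne hinv) (nhds p) (nhds (T p)) := by
    have := h1.continuousAt.tendsto
    rwa [cdf.implicitFunction_apply_self hne hinv] at this
  have h4 : cdf.implicitFunction hne hinv =ᶠ[nhds p] T := by
    filter_upwards [h2, h3 hV, hU] with q hq1 hq2 hq3
    exact huniq q hq3 _ hq2 (hq1.trans hzero)
  exact (ContDiffAt.analyticAt h1).congr h4

/-! ### Parametrization of level sets over a patch -/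

/-- The affine frame at `x₀` spanned by an orthonormal basis; the vector `b 0` is the last one. -/
noncomputable def realFrame {m : ℕ} (b : OrthonormalBasis (Fin (m + 1)) ℝ (EuclideanSpace ℝ (Fin (m + 1))))
    (x₀ : EuclideanSpace ℝ (Fin (m + 1))) (y : Fin m → ℝ) (t : ℝ) : EuclideanSpace ℝ (Fin (m + 1)) :=
  x₀ + (∑ j, y j • b j.succ + t • b 0)

/-- The complexification of `realFrame`. -/
noncomputable def complexFrame {m : ℕ} (b : OrthonormalBasis (Fin (m + 1)) ℝ (EuclideanSpace ℝ (Fin (m + 1))))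
    (x₀ : EuclideanSpace ℝ (Fin (m + 1))) (w : Fin m → ℂ) (t : ℂ) :
    EuclideanSpace ℂ (Fin (m + 1)) :=
  toComplexVec x₀ + (∑ j, w j • toComplexVec (b j.succ) + t • toComplexVec (b 0))

section Frame

variable {m : ℕ} (b : OrthonormalBasis (Fin (m + 1)) ℝ (EuclideanSpace ℝ (Fin (m + 1))))
  (x₀ : EuclideanSpace ℝ (Fin (m + 1)))

theorem complexFrame_ofReal (y : Fin m → ℝ) (t : ℝ) :
    complexFrame b x₀ (fun i => (y i : ℂ)) t = toComplexVec (realFrame b x₀ y t) := by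
  simp only [complexFrame, realFrame, toComplexVec_add, toComplexVec_sum, toComplexVec_smul]

theorem complexFrame_sub (w : Fin m → ℂ) (s t : ℂ) :
    complexFrame b x₀ w s - complexFrame b x₀ w t = (s - t) • toComplexVec (b 0) := by
  simp only [complexFrame, sub_smul]; abel

theorem norm_complexFrame_sub_le (w : Fin m → ℂ) (t : ℂ) :
    ‖complexFrame b x₀ w t - toComplexVec x₀‖ ≤ m * ‖w‖ + ‖t‖ := by
  rw [complexFrame, add_sub_cancel_left]
  refine (norm_add_le _ _).trans (add_le_add ?_ ?_)
  · refine (norm_sum_le_of_le _ fun j _ => ?_ : _ ≤ ∑ _j : Fin m, ‖w‖).trans_eq ?_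
    · rw [norm_smul, norm_toComplexVec, b.norm_eq_one, mul_one]
      exact norm_le_pi_norm w j
    · rw [Finset.sum_const, Finset.card_univ, Fintype.card_fin, nsmul_eq_mul]
  · rw [norm_smul, norm_toComplexVec, b.norm_eq_one, mul_one]

theorem contDiff_complexFrame :
    ContDiff ℂ ⊤ fun p : (Fin m → ℂ) × ℂ => complexFrame b x₀ p.1 p.2 := by
  unfold complexFrame
  fun_prop

end Frame

/-- A patch of size `r` around `x₀` on which `f` is nearly linear in the direction `b 0` of its
gradient, whose length is `g₀`. -/
structure LevelPatch {m : ℕ} (f : EuclideanSpace ℝ (Fin (m + 1)) → ℝ)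
    (b : OrthonormalBasis (Fin (m + 1)) ℝ (EuclideanSpace ℝ (Fin (m + 1))))
    (x₀ : EuclideanSpace ℝ (Fin (m + 1))) (r₀ K r g₀ : ℝ) : Prop where
  r_pos : 0 < r
  K_nonneg : 0 ≤ K
  g₀_pos : 0 < g₀
  fderiv_normal : fderiv ℝ f x₀ (b 0) = g₀
  fderiv_tangent : ∀ j : Fin m, fderiv ℝ f x₀ (b j.succ) = 0
  curvature : 112 * (m + 1) * (K * (14 * (m + 1) * r)) ≤ g₀
  r_le : 8 * r ≤ g₀
  subset : ‖x₀‖ + 14 * (m + 1) * r < r₀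

/-- The complex box on which a level set is parametrized. -/
def largeBox (m : ℕ) (r E₀ : ℝ) : Set ((Fin m → ℂ) × ℂ) :=
  {p | ‖p.1‖ < 13 * r ∧ ‖p.2 - (E₀ : ℂ)‖ < r ^ 2}

theorem isOpen_largeBox (m : ℕ) (r E₀ : ℝ) : IsOpen (largeBox m r E₀) := by
  exact (isOpen_lt (f := fun p : (Fin m → ℂ) × ℂ => ‖p.1‖) (by fun_prop) continuous_const).inter
    (isOpen_lt (f := fun p : (Fin m → ℂ) × ℂ => ‖p.2 - (E₀ : ℂ)‖) (by fun_prop) continuous_const)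

section Patch

variable {m : ℕ} {f : EuclideanSpace ℝ (Fin (m + 1)) → ℝ} {F : EuclideanSpace ℂ (Fin (m + 1)) → ℂ}
  {A : EuclideanSpace ℝ (Fin (m + 1)) →L[ℝ] EuclideanSpace ℝ (Fin (m + 1)) →L[ℝ] ℝ}
  {b : OrthonormalBasis (Fin (m + 1)) ℝ (EuclideanSpace ℝ (Fin (m + 1)))}
  {x₀ : EuclideanSpace ℝ (Fin (m + 1))} {r₀ ν₀ K r g₀ : ℝ}

/-- The tangential radius `13 * r` is the one the Cartan estimate requires; the `m` tangential terms
and the normal one add up to `13 * m * r + r`. -/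
theorem LevelPatch.norm_frame_sub_le (hP : LevelPatch f b x₀ r₀ K r g₀) {w : Fin m → ℂ} {t : ℂ}
    (hw : ‖w‖ < 13 * r) (ht : ‖t‖ ≤ r) :
    ‖complexFrame b x₀ w t - toComplexVec x₀‖ ≤ 14 * (m + 1) * r := by
  have hm : (0 : ℝ) ≤ m := m.cast_nonneg
  have := hP.r_pos
  refine (norm_complexFrame_sub_le b x₀ w t).trans ?_
  nlinarith [mul_le_mul_of_nonneg_left hw.le hm, mul_nonneg hm this.le]

theorem LevelPatch.mem_ball_of_norm_sub_le (hP : LevelPatch f b x₀ r₀ K r g₀)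
    {z : EuclideanSpace ℂ (Fin (m + 1))} (hz : ‖z - toComplexVec x₀‖ ≤ 14 * (m + 1) * r) :
    z ∈ ball (0 : EuclideanSpace ℂ (Fin (m + 1))) r₀ := by
  rw [mem_ball_zero_iff]
  have h1 := norm_sub_norm_le z (toComplexVec x₀)
  rw [norm_toComplexVec] at h1
  linarith [hP.subset]

theorem LevelPatch.base_mem (hP : LevelPatch f b x₀ r₀ K r g₀) :
    x₀ ∈ ball (0 : EuclideanSpace ℝ (Fin (m + 1))) r₀ := by
  rw [mem_ball_zero_iff]
  have := hP.r_pos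
  have h1 : 0 ≤ 14 * ((m : ℝ) + 1) * r := by positivity
  linarith [hP.subset]

/-- The curvature condition says that the gradient moves by at most `g₀ / (112 * (m + 1))` across
the patch. This is stronger than the contraction needs; the surplus makes level sets nearly flat in
`LevelPatch.slope_le`. -/
theorem LevelPatch.taylor (hP : LevelPatch f b x₀ r₀ K r g₀) (hM : NondegMin f F A r₀ ν₀ K)
    {x y : EuclideanSpace ℂ (Fin (m + 1))} (hx : ‖x - toComplexVec x₀‖ ≤ 14 * (m + 1) * r)
    (hy : ‖y - toComplexVec x₀‖ ≤ 14 * (m + 1) * r) :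
    ‖F y - F x - fderiv ℂ F (toComplexVec x₀) (y - x)‖ ≤ g₀ / (112 * (m + 1)) * ‖y - x‖ := by
  have h0 : ‖toComplexVec x₀ - toComplexVec x₀‖ ≤ 14 * (m + 1) * r := by
    rw [sub_self, norm_zero]; exact (norm_nonneg _).trans hx
  refine (norm_sub_sub_fderiv_le hP.K_nonneg (fun z hz => (hM.analytic z hz).differentiableAt) hM.lip
    (hP.mem_ball_of_norm_sub_le h0) (hP.mem_ball_of_norm_sub_le hx)
    (hP.mem_ball_of_norm_sub_le hy) hx hy).trans ?_
  refine mul_le_mul_of_nonneg_right ?_ (norm_nonneg _)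
  rw [le_div_iff₀ (by positivity)]
  linarith [hP.curvature]

theorem LevelPatch.fderiv_complex (hP : LevelPatch f b x₀ r₀ K r g₀) (hM : NondegMin f F A r₀ ν₀ K) :
    fderiv ℂ F (toComplexVec x₀) (toComplexVec (b 0)) = g₀ := by
  rw [hM.fderiv_extends x₀ hP.base_mem, hP.fderiv_normal]

theorem LevelPatch.near_linear (hP : LevelPatch f b x₀ r₀ K r g₀) (hM : NondegMin f F A r₀ ν₀ K)
    {w : Fin m → ℂ} (hw : ‖w‖ < 13 * r) {s t : ℂ} (hs : ‖s‖ ≤ r) (ht : ‖t‖ ≤ r) :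
    ‖F (complexFrame b x₀ w s) - F (complexFrame b x₀ w t) - g₀ * (s - t)‖ ≤
      g₀ / 4 * ‖s - t‖ := by
  have h := hP.taylor hM (hP.norm_frame_sub_le hw ht) (hP.norm_frame_sub_le hw hs)
  rw [complexFrame_sub, map_smul, hP.fderiv_complex hM, smul_eq_mul, norm_smul, norm_toComplexVec,
    b.norm_eq_one, mul_one, mul_comm (s - t)] at h
  refine h.trans (mul_le_mul_of_nonneg_right ?_ (norm_nonneg _))
  refine div_le_div_of_nonneg_left hP.g₀_pos.le (by norm_num) ?_
  have hm : (0 : ℝ) ≤ m := m.cast_nonneg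
  linarith

/-- Tangent vectors lie in the kernel of the differential at `x₀`, so only the Taylor error `g₀ * r
/ 8` remains. The energy shift `r ^ 2` adds at most the same amount, because `8 * r ≤ g₀`. -/
theorem LevelPatch.base_value (hP : LevelPatch f b x₀ r₀ K r g₀) (hM : NondegMin f F A r₀ ν₀ K)
    {w : Fin m → ℂ} (hw : ‖w‖ < 13 * r) {E : ℂ} (hE : ‖E - (f x₀ : ℂ)‖ < r ^ 2) :
    ‖F (complexFrame b x₀ w 0) - E‖ ≤ g₀ * r / 4 := by
  have hr := hP.r_pos
  have h0 : ‖(0 : ℂ)‖ ≤ r := by rw [norm_zero]; exact hr.le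
  have h1 := hP.norm_frame_sub_le hw h0
  have h := hP.taylor hM (x := toComplexVec x₀)
    (by rw [sub_self, norm_zero]; exact (norm_nonneg _).trans h1) h1
  have h2 : fderiv ℂ F (toComplexVec x₀) (complexFrame b x₀ w 0 - toComplexVec x₀) = 0 := by
    rw [complexFrame, add_sub_cancel_left, zero_smul, add_zero, map_sum]
    refine Finset.sum_eq_zero fun j _ => ?_
    rw [map_smul, hM.fderiv_extends x₀ hP.base_mem, hP.fderiv_tangent, Complex.ofReal_zero,
      smul_zero]
  rw [h2, sub_zero, hM.extends_real x₀ hP.base_mem] at h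
  have h3 : ‖F (complexFrame b x₀ w 0) - E‖ ≤
      ‖F (complexFrame b x₀ w 0) - (f x₀ : ℂ)‖ + ‖E - (f x₀ : ℂ)‖ := by
    rw [← norm_neg (E - _), neg_sub]
    simpa using norm_add_le (F (complexFrame b x₀ w 0) - (f x₀ : ℂ)) ((f x₀ : ℂ) - E)
  have h4 : g₀ / (112 * ((m : ℝ) + 1)) * ‖complexFrame b x₀ w 0 - toComplexVec x₀‖ ≤
      g₀ * r / 8 := by
    refine (mul_le_mul_of_nonneg_left h1 (div_nonneg hP.g₀_pos.le (by positivity))).trans_eq ?_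
    have : (m : ℝ) + 1 ≠ 0 := by positivity
    field_simp; ring
  nlinarith [mul_le_mul_of_nonneg_right hP.r_le hr.le]

theorem LevelPatch.exists_solution (hP : LevelPatch f b x₀ r₀ K r g₀)
    (hM : NondegMin f F A r₀ ν₀ K) {w : Fin m → ℂ} (hw : ‖w‖ < 13 * r) {E : ℂ}
    (hE : ‖E - (f x₀ : ℂ)‖ < r ^ 2) :
    ∃ t : ℂ, ‖t‖ ≤ r / 2 ∧ F (complexFrame b x₀ w t) = E ∧
      ∀ s, ‖s‖ ≤ r → F (complexFrame b x₀ w s) = E → s = t := by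
  obtain ⟨t, ht, hgt, hu⟩ := exists_unique_zero_of_near_linear (𝕜 := ℂ)
    (g := fun t => F (complexFrame b x₀ w t) - E) hP.g₀_pos hP.r_pos
    (fun s t hs ht => by simpa using hP.near_linear hM hw hs ht) (hP.base_value hM hw hE)
  exact ⟨t, ht, sub_eq_zero.1 hgt, fun s hs h => hu s hs (sub_eq_zero.2 h)⟩

theorem norm_ofReal_pi_lt {m : ℕ} {y : Fin m → ℝ} {R : ℝ} (hR : 0 < R) (hy : ‖y‖ < R) :
    ‖fun i => (y i : ℂ)‖ < R := by
  rw [pi_norm_lt_iff hR] at hy ⊢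
  intro i; rw [Complex.norm_real]; exact hy i

theorem LevelPatch.extends_frame (hP : LevelPatch f b x₀ r₀ K r g₀) (hM : NondegMin f F A r₀ ν₀ K)
    {y : Fin m → ℝ} (hy : ‖y‖ < 13 * r) {t : ℝ} (ht : |t| ≤ r) :
    realFrame b x₀ y t ∈ ball (0 : EuclideanSpace ℝ (Fin (m + 1))) r₀ ∧
      F (complexFrame b x₀ (fun i => (y i : ℂ)) t) = f (realFrame b x₀ y t) := by
  have hr := hP.r_pos
  have h1 := hP.mem_ball_of_norm_sub_le (hP.norm_frame_sub_le (t := t)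
    (norm_ofReal_pi_lt (by positivity) hy) (by rwa [Complex.norm_real]))
  rw [complexFrame_ofReal, mem_ball_zero_iff, norm_toComplexVec] at h1
  have h2 := mem_ball_zero_iff.2 h1
  exact ⟨h2, by rw [complexFrame_ofReal, hM.extends_real _ h2]⟩

/-- A separate real contraction shows that the complex root is real at real parameters: the two
coincide by complex uniqueness. -/
theorem LevelPatch.exists_real_solution (hP : LevelPatch f b x₀ r₀ K r g₀)
    (hM : NondegMin f F A r₀ ν₀ K) {y : Fin m → ℝ} (hy : ‖y‖ < 13 * r) {E : ℝ}
    (hE : |E - f x₀| < r ^ 2) :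
    ∃ t : ℝ, |t| ≤ r / 2 ∧ f (realFrame b x₀ y t) = E := by
  have hr := hP.r_pos
  have hyC : ‖fun i => (y i : ℂ)‖ < 13 * r := norm_ofReal_pi_lt (by positivity) hy
  obtain ⟨t, ht, hgt, -⟩ := exists_unique_zero_of_near_linear (𝕜 := ℝ)
    (g := fun t => f (realFrame b x₀ y t) - E) hP.g₀_pos hr (fun s t hs ht => by
      have h := hP.near_linear hM hyC (s := s) (t := t) (by rwa [Complex.norm_real])
        (by rwa [Complex.norm_real])
      rw [(hP.extends_frame hM hy hs).2, (hP.extends_frame hM hy ht).2] at h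
      norm_cast at h
      simpa using h) (by
      have h := hP.base_value hM hyC (E := E) (by norm_cast)
      rw [← Complex.ofReal_zero, (hP.extends_frame hM hy (by rw [abs_zero]; exact hr.le)).2] at h
      norm_cast at h)
  exact ⟨t, ht, sub_eq_zero.1 hgt⟩

theorem LevelPatch.exists_parametrization (hP : LevelPatch f b x₀ r₀ K r g₀)
    (hM : NondegMin f F A r₀ ν₀ K) :
    ∃ (T : (Fin m → ℂ) × ℂ → ℂ) (t : (Fin m → ℝ) × ℝ → ℝ),
      AnalyticOnNhd ℂ T (largeBox m r (f x₀)) ∧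
      (∀ p ∈ largeBox m r (f x₀), ‖T p‖ ≤ r / 2 ∧ F (complexFrame b x₀ p.1 (T p)) = p.2) ∧
      (∀ (y : Fin m → ℝ) (E : ℝ), ‖y‖ < 13 * r → |E - f x₀| < r ^ 2 →
        T (fun i => (y i : ℂ), (E : ℂ)) = t (y, E) ∧ |t (y, E)| ≤ r / 2 ∧
        f (realFrame b x₀ y (t (y, E))) = E) ∧
      (∀ p, t p = (T (fun i => (p.1 i : ℂ), (p.2 : ℂ))).re) ∧
      T (0, (f x₀ : ℂ)) = 0 := by
  have hr := hP.r_pos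
  -- The implication is placed inside so that `choose` returns a total function; its values off the
  -- box play no role.
  have hex : ∀ p : (Fin m → ℂ) × ℂ, ∃ t : ℂ, p ∈ largeBox m r (f x₀) →
      ‖t‖ ≤ r / 2 ∧ F (complexFrame b x₀ p.1 t) = p.2 ∧
      ∀ s, ‖s‖ ≤ r → F (complexFrame b x₀ p.1 s) = p.2 → s = t := by
    intro p
    by_cases hp : p ∈ largeBox m r (f x₀)
    · obtain ⟨t, ht⟩ := hP.exists_solution hM hp.1 hp.2
      exact ⟨t, fun _ => ht⟩
    · exact ⟨0, fun h => absurd h hp⟩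
  choose T hT using hex
  refine ⟨T, fun p => (T (fun i => (p.1 i : ℂ), (p.2 : ℂ))).re, ?_,
    fun p hp => ⟨(hT p hp).1, (hT p hp).2.1⟩, ?_, fun _ => rfl, ?_⟩
  · intro p hp
    obtain ⟨h1, h2, -⟩ := hT p hp
    have hz := hP.mem_ball_of_norm_sub_le (hP.norm_frame_sub_le hp.1 (h1.trans (by linarith)))
    have hfr : ContDiff ℂ ⊤ fun q : ((Fin m → ℂ) × ℂ) × ℂ => complexFrame b x₀ q.1.1 q.2 :=
      (contDiff_complexFrame b x₀).comp (contDiff_fst.fst.prodMk contDiff_snd)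
    have hΦ : AnalyticAt ℂ
        (fun q : ((Fin m → ℂ) × ℂ) × ℂ => F (complexFrame b x₀ q.1.1 q.2) - q.1.2) (p, T p) := by
      refine AnalyticAt.sub ?_ ?_
      · exact AnalyticAt.comp (f := fun q : ((Fin m → ℂ) × ℂ) × ℂ => complexFrame b x₀ q.1.1 q.2)
          (hM.analytic _ hz) hfr.contDiffAt.analyticAt
      · exact (contDiff_fst.snd (n := ⊤)).contDiffAt.analyticAt
    refine analyticAt_of_unique_solution (U := largeBox m r (f x₀)) (V := ball 0 r)
      ((isOpen_largeBox m r _).mem_nhds hp)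
      (isOpen_ball.mem_nhds (mem_ball_zero_iff.2 (by linarith))) hΦ (sub_eq_zero.2 h2) ?_ ?_
    · have e1 : HasDerivAt (fun t : ℂ => (p, t)) (0, 1) (T p) :=
        (hasDerivAt_const _ _).prodMk (hasDerivAt_id _)
      have e2 := HasFDerivAt.comp_hasDerivAt (T p) hΦ.differentiableAt.hasFDerivAt e1
      have e3 : HasDerivAt (fun t : ℂ => complexFrame b x₀ p.1 t) (toComplexVec (b 0)) (T p) := by
        have := (((hasDerivAt_id (T p)).smul_const (toComplexVec (b 0))).const_add
          (∑ j, p.1 j • toComplexVec (b j.succ))).const_add (toComplexVec x₀)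
        simpa [complexFrame] using this
      have e4 := (HasFDerivAt.comp_hasDerivAt (T p) (hM.analytic _ hz).differentiableAt.hasFDerivAt
        e3).sub_const p.2
      rw [e2.unique e4]
      -- A vanishing normal derivative would make the gradient change by at least `g₀` within the
      -- patch, against the curvature condition.
      intro hzero
      have h5 := (fderiv ℂ F (complexFrame b x₀ p.1 (T p)) -
        fderiv ℂ F (toComplexVec x₀)).le_of_opNorm_le (hM.lip _ hz _ (hP.mem_ball_of_norm_sub_le
          (by rw [sub_self, norm_zero]; positivity))) (toComplexVec (b 0))
      rw [sub_apply, hzero, hP.fderiv_complex hM, zero_sub, norm_neg, Complex.norm_real,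
        Real.norm_of_nonneg hP.g₀_pos.le, norm_toComplexVec, b.norm_eq_one, mul_one] at h5
      have h6 := mul_le_mul_of_nonneg_left
        (hP.norm_frame_sub_le hp.1 (h1.trans (by linarith : r / 2 ≤ r))) hP.K_nonneg
      have h7 := hP.curvature
      have h8 := hP.g₀_pos
      have hm : (0 : ℝ) ≤ m := m.cast_nonneg
      have h9 : 0 ≤ K * (14 * (m + 1) * r) := mul_nonneg hP.K_nonneg (by positivity)
      nlinarith [mul_nonneg hm h9]
    · intro q hq t ht h
      exact (hT q hq).2.2 t (mem_ball_zero_iff.1 ht).le (sub_eq_zero.1 h)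
  · intro y E hy hE
    obtain ⟨t, ht, hft⟩ := hP.exists_real_solution hM hy hE
    have hmem : ((fun i => (y i : ℂ)), (E : ℂ)) ∈ largeBox m r (f x₀) :=
      ⟨norm_ofReal_pi_lt (by positivity) hy, by
        change ‖(E : ℂ) - (f x₀ : ℂ)‖ < r ^ 2
        norm_cast⟩
    have h1 : (t : ℂ) = T (fun i => (y i : ℂ), (E : ℂ)) := by
      refine (hT _ hmem).2.2 t (by rw [Complex.norm_real, Real.norm_eq_abs]; linarith) ?_
      rw [(hP.extends_frame hM hy (ht.trans (by linarith))).2, hft]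
    simp only [← h1, Complex.ofReal_re]
    exact ⟨trivial, ht, hft⟩
  · have hmem : ((0 : Fin m → ℂ), (f x₀ : ℂ)) ∈ largeBox m r (f x₀) :=
      ⟨by simp; positivity, by simp; positivity⟩
    refine ((hT _ hmem).2.2 0 (by rw [norm_zero]; exact hr.le) ?_).symm
    have : complexFrame b x₀ 0 0 = toComplexVec x₀ := by simp [complexFrame]
    rw [this, hM.extends_real _ hP.base_mem]

end Patch

/-! ### Convexity, adapted frames and flatness of level sets -/

section Geometry

variable {m : ℕ} {f : EuclideanSpace ℝ (Fin (m + 1)) → ℝ} {F : EuclideanSpace ℂ (Fin (m + 1)) → ℂ}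
  {A : EuclideanSpace ℝ (Fin (m + 1)) →L[ℝ] EuclideanSpace ℝ (Fin (m + 1)) →L[ℝ] ℝ}
  {b : OrthonormalBasis (Fin (m + 1)) ℝ (EuclideanSpace ℝ (Fin (m + 1)))}
  {x₀ : EuclideanSpace ℝ (Fin (m + 1))} {r₀ ν₀ K r g₀ : ℝ}

/-- Strong midpoint convexity near a nondegenerate minimum. -/
theorem NondegMin.midpoint_convex (hM : NondegMin f F A r₀ ν₀ K) {R : ℝ} (hR : R < r₀)
    (hKR : K * R ≤ ν₀ / 2) {c d : EuclideanSpace ℝ (Fin (m + 1))} (h1 : ‖c + d‖ ≤ R)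
    (h2 : ‖c - d‖ ≤ R) : ν₀ / 2 * ‖d‖ ^ 2 ≤ f (c + d) + f (c - d) - 2 * f c := by
  have hmem : ∀ u ∈ Set.Icc (-1 : ℝ) 1, ‖c + u • d‖ ≤ R := by
    intro u hu
    have hc := (convex_closedBall (0 : EuclideanSpace ℝ (Fin (m + 1))) R)
      (mem_closedBall_zero_iff.2 h1) (mem_closedBall_zero_iff.2 h2)
      (a := (1 + u) / 2) (b := (1 - u) / 2) (by linarith [hu.1]) (by linarith [hu.2]) (by ring)
    rw [mem_closedBall_zero_iff] at hc
    have e : ((1 + u) / 2) • (c + d) + ((1 - u) / 2) • (c - d) = c + u • d := by module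
    rwa [e] at hc
  have hder : ∀ u ∈ Set.Icc (-1 : ℝ) 1,
      HasDerivAt (fun u : ℝ => f (c + u • d)) (fderiv ℝ f (c + u • d) d) u := by
    intro u hu
    have e : HasDerivAt (fun u : ℝ => c + u • d) d u := by
      simpa using ((hasDerivAt_id u).smul_const d).const_add c
    exact HasFDerivAt.comp_hasDerivAt u
      (hM.diff _ (mem_ball_zero_iff.2 ((hmem u hu).trans_lt hR))).hasFDerivAt e
  have hder' : ∀ u ∈ Set.Icc (0 : ℝ) 1, HasDerivAt
      (fun u : ℝ => f (c + u • d) + f (c + (-u) • d) - ν₀ / 2 * ‖d‖ ^ 2 * u ^ 2)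
      (fderiv ℝ f (c + u • d) d - fderiv ℝ f (c + (-u) • d) d - ν₀ * ‖d‖ ^ 2 * u) u := by
    intro u hu
    have e1 := hder u ⟨by linarith [hu.1], hu.2⟩
    have e2 := HasDerivAt.scomp u (hder (-u) ⟨by linarith [hu.2], by linarith [hu.1]⟩)
      (hasDerivAt_neg u)
    have e3 := ((hasDerivAt_id u).pow 2).const_mul (ν₀ / 2 * ‖d‖ ^ 2)
    refine ((e1.add e2).sub e3).congr_deriv ?_
    simp only [smul_eq_mul, id]
    push_cast; ring
  have hmono : MonotoneOn
      (fun u : ℝ => f (c + u • d) + f (c + (-u) • d) - ν₀ / 2 * ‖d‖ ^ 2 * u ^ 2)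
      (Set.Icc 0 1) := by
    refine monotoneOn_of_deriv_nonneg (convex_Icc 0 1)
      (fun u hu => (hder' u hu).continuousAt.continuousWithinAt)
      (fun u hu => (hder' u (interior_subset hu)).differentiableAt.differentiableWithinAt)
      (fun u hu => ?_)
    have hu := interior_subset hu
    rw [(hder' u hu).deriv]
    -- The Hessian contributes at least `2 * u * ν₀ * ‖d‖ ^ 2` and the error takes at most half of
    -- it; the other half pays for the subtracted quadratic.
    have e1 := hM.hess_approx R hR _ _ (hmem u ⟨by linarith [hu.1], hu.2⟩)
      (hmem (-u) ⟨by linarith [hu.2], by linarith [hu.1]⟩)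
    have e2 : c + u • d - (c + (-u) • d) = (2 * u) • d := by module
    rw [e2, norm_smul, Real.norm_of_nonneg (by linarith [hu.1])] at e1
    have e3 := ContinuousLinearMap.le_of_opNorm_le _ e1 d
    rw [sub_apply, sub_apply, map_smul, smul_apply, smul_eq_mul, Real.norm_eq_abs] at e3
    have e4 := (abs_le.1 e3).1
    have e5 := mul_le_mul_of_nonneg_left (hM.hess_pos d) (by linarith [hu.1] : 0 ≤ 2 * u)
    have e6 := mul_le_mul_of_nonneg_right hKR (mul_nonneg (by linarith [hu.1] : 0 ≤ 2 * u)
      (sq_nonneg ‖d‖))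
    nlinarith
  have := hmono (Set.left_mem_Icc.2 zero_le_one) (Set.right_mem_Icc.2 zero_le_one) zero_le_one
  simp only [zero_smul, neg_zero, add_zero, one_smul, neg_smul, one_pow, mul_one, zero_pow two_ne_zero,
    mul_zero, sub_zero, ← sub_eq_add_neg] at this
  linarith

theorem NondegMin.norm_fderiv_le (hM : NondegMin f F A r₀ ν₀ K)
    {x : EuclideanSpace ℝ (Fin (m + 1))} (hx : ‖x‖ < r₀) : ‖fderiv ℝ f x‖ ≤ K * ‖x‖ := by
  have h := hM.lip_real x (mem_ball_zero_iff.2 hx) 0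
    (mem_ball_self ((norm_nonneg x).trans_lt hx))
  rwa [hM.fderiv_zero, sub_zero, sub_zero] at h

/-- An adapted orthonormal basis at a point near the minimum. -/
theorem NondegMin.exists_levelPatch (hM : NondegMin f F A r₀ ν₀ K) {ν₁ : ℝ} (hr₀ : r₀ < 1)
    (hr₀' : 0 < r₀) (hν₀ : ν₀ < 1) (hν₁ : 0 < ν₁) (hK : 1 ≤ K)
    (hKν : 4000 * (m + 1) ^ 2 * (K * ν₁) ≤ ν₀) (hx₀ : 0 < ‖x₀‖) (hx₀' : ‖x₀‖ < r₀ * ν₁ ^ 10) :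
    ∃ (b : OrthonormalBasis (Fin (m + 1)) ℝ (EuclideanSpace ℝ (Fin (m + 1)))) (g₀ : ℝ),
      LevelPatch f b x₀ r₀ K (ν₁ * ‖x₀‖) g₀ := by
  have hm : (0 : ℝ) ≤ m := m.cast_nonneg
  have hKν1 : 0 < K * ν₁ := by positivity
  have hm2 : 1 ≤ ((m : ℝ) + 1) ^ 2 := by nlinarith
  have hKν' : 4000 * (K * ν₁) ≤ ν₀ := by nlinarith
  have hν₁K : ν₁ ≤ K * ν₁ := by nlinarith
  have hν₁1 : ν₁ ≤ 1 := by linarith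
  have hpow : ν₁ ^ 10 ≤ ν₁ := pow_le_of_le_one hν₁.le hν₁1 (by norm_num)
  have hxν : ‖x₀‖ ≤ ν₁ := by nlinarith
  have hxr : ‖x₀‖ ≤ r₀ * ν₁ := hx₀'.le.trans (by gcongr)
  have hKx : K * ‖x₀‖ ≤ ν₀ / 2 := by nlinarith
  have hxr₀ : ‖x₀‖ < r₀ := by nlinarith
  -- Testing the differential on `x₀` itself: the Hessian gives `ν₀ * ‖x₀‖ ^ 2`, and the cubic error
  -- is at most half of that.
  have hlow : ν₀ / 2 * ‖x₀‖ ≤ ‖fderiv ℝ f x₀‖ := by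
    have e1 := hM.hess_approx ‖x₀‖ hxr₀ x₀ 0 le_rfl (by rw [norm_zero]; exact hx₀.le)
    rw [hM.fderiv_zero, sub_zero, sub_zero] at e1
    have e2 := ContinuousLinearMap.le_of_opNorm_le _ e1 x₀
    rw [sub_apply, Real.norm_eq_abs] at e2
    have e3 := (abs_le.1 e2).1
    have e4 := hM.hess_pos x₀
    have e5 := (le_abs_self _).trans ((fderiv ℝ f x₀).le_opNorm x₀)
    have e6 := mul_le_mul_of_nonneg_right hKx (sq_nonneg ‖x₀‖)
    have e7 : ν₀ / 2 * ‖x₀‖ * ‖x₀‖ ≤ ‖fderiv ℝ f x₀‖ * ‖x₀‖ := by nlinarith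
    exact le_of_mul_le_mul_right e7 hx₀
  set G := gradient f x₀ with hG
  have hinner : ∀ u, fderiv ℝ f x₀ u = inner ℝ G u := fun u => by
    rw [← InnerProductSpace.toDual_apply_apply, hG, toDual_gradient]
  have hnG : ‖G‖ = ‖fderiv ℝ f x₀‖ := by
    rw [← toDual_gradient, LinearIsometryEquiv.norm_map]
  have hν₀0 : 0 < ν₀ := by linarith
  have hG0 : 0 < ‖G‖ := by rw [hnG]; exact lt_of_lt_of_le (by positivity) hlow
  obtain ⟨b, hb⟩ := Orthonormal.exists_orthonormalBasis_extension_of_card_eq (𝕜 := ℝ)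
    (E := EuclideanSpace ℝ (Fin (m + 1))) (ι := Fin (m + 1)) (by simp)
    (v := fun _ => ‖G‖⁻¹ • G) (s := {0}) (by
      refine ⟨fun i => ?_, fun i j hij => absurd (Subsingleton.elim i j) hij⟩
      rw [Set.domRestrict_apply, norm_smul, norm_inv, norm_norm, inv_mul_cancel₀ hG0.ne'])
  have hb0 : b 0 = ‖G‖⁻¹ • G := hb 0 rfl
  have hGb : G = ‖G‖ • b 0 := by rw [hb0, smul_smul, mul_inv_cancel₀ hG0.ne', one_smul]
  have hinner' : ∀ u, fderiv ℝ f x₀ u = ‖G‖ * inner ℝ (b 0) u := fun u => by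
    rw [hinner]; conv_lhs => rw [hGb]
    rw [real_inner_smul_left]
  refine ⟨b, ‖G‖, by positivity, by linarith, hG0, ?_, fun j => ?_, ?_, ?_, ?_⟩
  · rw [hinner', real_inner_self_eq_norm_sq, b.norm_eq_one]; norm_num
  · rw [hinner', b.inner_eq_zero (Fin.succ_ne_zero j).symm, mul_zero]
  -- The constant 4000 suffices here: the curvature condition needs `112 * 14 * (m + 1) ^ 2 * (K *
  -- ν₁) ≤ ν₀ / 2`, and `2 * 112 * 14 = 3136`.
  · rw [hnG]
    refine le_trans ?_ hlow
    nlinarith [mul_le_mul_of_nonneg_right hKν hx₀.le,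
      mul_nonneg (mul_nonneg (sq_nonneg ((m : ℝ) + 1)) hKν1.le) hx₀.le]
  · rw [hnG]
    refine le_trans ?_ hlow
    nlinarith
  · have e1 : (m + 1) * ν₁ ≤ 1 / 4000 := by nlinarith
    have e2 : ‖x₀‖ ≤ r₀ / 2 := by nlinarith
    nlinarith

theorem LevelPatch.taylor_real (hP : LevelPatch f b x₀ r₀ K r g₀) (hM : NondegMin f F A r₀ ν₀ K)
    {x y : EuclideanSpace ℝ (Fin (m + 1))} (hx : ‖x - x₀‖ ≤ 14 * (m + 1) * r)
    (hy : ‖y - x₀‖ ≤ 14 * (m + 1) * r) :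
    |f y - f x - fderiv ℝ f x₀ (y - x)| ≤ g₀ / (112 * (m + 1)) * ‖y - x‖ := by
  have hmem : ∀ z : EuclideanSpace ℝ (Fin (m + 1)), ‖z - x₀‖ ≤ 14 * (m + 1) * r →
      z ∈ ball (0 : EuclideanSpace ℝ (Fin (m + 1))) r₀ := by
    intro z hz
    rw [mem_ball_zero_iff]
    linarith [hP.subset, norm_sub_norm_le z x₀]
  refine (norm_sub_sub_fderiv_le hP.K_nonneg hM.diff hM.lip_real hP.base_mem (hmem x hx) (hmem y hy)
    hx hy).trans (mul_le_mul_of_nonneg_right ?_ (norm_nonneg _))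
  rw [le_div_iff₀ (by positivity)]
  linarith [hP.curvature]

/-- Two points of the same level set in a patch differ mostly in the tangential directions. -/
theorem LevelPatch.slope_le (hP : LevelPatch f b x₀ r₀ K r g₀) (hM : NondegMin f F A r₀ ν₀ K)
    {x y τ : EuclideanSpace ℝ (Fin (m + 1))} {δ : ℝ} (hx : ‖x - x₀‖ ≤ 14 * (m + 1) * r)
    (hy : ‖y - x₀‖ ≤ 14 * (m + 1) * r) (hxy : f x = f y) (hτ : fderiv ℝ f x₀ τ = 0)
    (hsub : y - x = τ + δ • b 0) : |δ| * (100 * (m + 1)) ≤ ‖τ‖ := by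
  have h := hP.taylor_real hM hx hy
  rw [hxy, sub_self, zero_sub, abs_neg, hsub, map_add, hτ, map_smul, hP.fderiv_normal, zero_add,
    smul_eq_mul, abs_mul, abs_of_pos hP.g₀_pos, div_mul_eq_mul_div, le_div_iff₀ (by positivity)] at h
  have h1 : ‖τ + δ • b 0‖ ≤ ‖τ‖ + |δ| := by
    refine (norm_add_le _ _).trans ?_
    rw [norm_smul, b.norm_eq_one, mul_one, Real.norm_eq_abs]
  have h2 : |δ| * (112 * (m + 1)) ≤ ‖τ‖ + |δ| := by
    refine le_of_mul_le_mul_left ?_ hP.g₀_pos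
    linarith [mul_le_mul_of_nonneg_left h1 hP.g₀_pos.le]
  have hm : (0 : ℝ) ≤ m := m.cast_nonneg
  nlinarith [abs_nonneg δ, mul_nonneg hm (abs_nonneg δ)]

end Geometry

/-! ### A nearly linear function is not small on a whole level patch -/

section Nondegeneracy

variable {m : ℕ} {f : EuclideanSpace ℝ (Fin (m + 1)) → ℝ} {F : EuclideanSpace ℂ (Fin (m + 1)) → ℂ}
  {A : EuclideanSpace ℝ (Fin (m + 1)) →L[ℝ] EuclideanSpace ℝ (Fin (m + 1)) →L[ℝ] ℝ}
  {b : OrthonormalBasis (Fin (m + 1)) ℝ (EuclideanSpace ℝ (Fin (m + 1)))}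
  {x₀ : EuclideanSpace ℝ (Fin (m + 1))} {r₀ ν₀ K r g₀ : ℝ}

theorem realFrame_single (b : OrthonormalBasis (Fin (m + 1)) ℝ (EuclideanSpace ℝ (Fin (m + 1))))
    (x₀ : EuclideanSpace ℝ (Fin (m + 1))) (j : Fin m) (s t : ℝ) :
    realFrame b x₀ (Pi.single j s) t = x₀ + (s • b j.succ + t • b 0) := by
  rw [realFrame, Finset.sum_eq_single j]
  · rw [Pi.single_eq_same]
  · intro i _ hij
    rw [Pi.single_eq_of_ne hij, zero_smul]
  · simp

theorem LevelPatch.norm_realFrame_sub_le (hP : LevelPatch f b x₀ r₀ K r g₀) {y : Fin m → ℝ}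
    {t : ℝ} (hy : ‖y‖ < 13 * r) (ht : |t| ≤ r) :
    ‖realFrame b x₀ y t - x₀‖ ≤ 14 * (m + 1) * r := by
  have hr := hP.r_pos
  have h := hP.norm_frame_sub_le (t := t) (norm_ofReal_pi_lt (by positivity) hy)
    (by rwa [Complex.norm_real])
  rwa [complexFrame_ofReal, ← toComplexVec_sub, norm_toComplexVec] at h

/-- A large functional is large on the normal or on one of the tangent vectors of a frame. -/
theorem exists_tangent_ge {v : EuclideanSpace ℝ (Fin (m + 1)) →L[ℝ] ℝ} {a : ℝ} (ha : 0 < a)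
    {u : EuclideanSpace ℝ (Fin (m + 1))} (hu : ‖u‖ = 1) (hv : a ≤ v u) (hn : |v (b 0)| < a / 2) :
    ∃ j : Fin m, a ≤ 2 * (m + 1) * |v (b j.succ)| := by
  by_contra! hcon
  have h1 : v u = ∑ i, b.repr u i * v (b i) := by
    conv_lhs => rw [← b.sum_repr u]
    simp only [map_sum, map_smul, smul_eq_mul]
  have h2 : ∀ i, b.repr u i * v (b i) ≤ |v (b i)| := by
    intro i
    refine (le_abs_self _).trans ?_
    rw [abs_mul]
    refine mul_le_of_le_one_left (abs_nonneg _) ?_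
    have := PiLp.norm_apply_le (b.repr u) i
    rwa [LinearIsometryEquiv.norm_map, hu] at this
  have h3 : v u ≤ |v (b 0)| + ∑ j : Fin m, |v (b j.succ)| := by
    rw [h1, ← Fin.sum_univ_succ (fun i => |v (b i)|)]
    exact Finset.sum_le_sum fun i _ => h2 i
  have h4 : ∑ j : Fin m, |v (b j.succ)| ≤ ∑ _j : Fin m, a / (2 * (m + 1)) := by
    refine Finset.sum_le_sum fun j _ => ?_
    rw [le_div_iff₀ (by positivity)]
    linarith [hcon j]
  rw [Finset.sum_const, Finset.card_univ, Fintype.card_fin, nsmul_eq_mul] at h4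
  have h5 : (m : ℝ) * (a / (2 * (m + 1))) ≤ a / 2 := by
    rw [mul_div_assoc', div_le_div_iff₀ (by positivity) (by norm_num)]
    nlinarith
  linarith

/-- A level set is curved: the chord between `x₀ ± s τ` stays away from the point over `x₀`. -/
theorem LevelPatch.second_difference_ge (hP : LevelPatch f b x₀ r₀ K r g₀)
    (hM : NondegMin f F A r₀ ν₀ K) (hν₀ : 0 < ν₀) {ν₁ : ℝ} (hν₁ : 0 < ν₁)
    (hx₀ : 0 < ‖x₀‖) (hr : r = ν₁ * ‖x₀‖) (hrx : 14 * (m + 1) * r ≤ ‖x₀‖) (hx₀r : 2 * ‖x₀‖ < r₀)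
    (hKx : K * (2 * ‖x₀‖) ≤ ν₀ / 2) (hKν : 4000 * (K * ν₁) ≤ ν₀) (j : Fin m)
    {tc t₁ t₂ E : ℝ} (htc : |tc| ≤ r) (ht₁ : |t₁| ≤ r) (ht₂ : |t₂| ≤ r)
    (hc : f (x₀ + tc • b 0) = E)
    (h₁ : f (x₀ + ((r / 2) • b j.succ + t₁ • b 0)) = E)
    (h₂ : f (x₀ + ((-(r / 2)) • b j.succ + t₂ • b 0)) = E)
    (hd : |t₁ - t₂| ≤ r / 4) :
    50 * ν₁ ^ 2 * r ≤ |t₁ + t₂ - 2 * tc| := by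
  have hr0 := hP.r_pos
  have hK := hP.K_nonneg
  have hm : (0 : ℝ) ≤ m := m.cast_nonneg
  have hnear : ∀ s t : ℝ, |s| ≤ r → |t| ≤ r →
      ‖x₀ + (s • b j.succ + t • b 0)‖ ≤ 2 * ‖x₀‖ := by
    intro s t hs ht
    have e1 := norm_add_le x₀ (s • b j.succ + t • b 0)
    have e2 := norm_add_le (s • b j.succ) (t • b 0)
    rw [norm_smul, norm_smul, b.norm_eq_one, b.norm_eq_one, mul_one, mul_one, Real.norm_eq_abs,
      Real.norm_eq_abs] at e2
    nlinarith
  have hs : |r / 2| ≤ r := by rw [abs_of_pos (by positivity)]; linarith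
  -- The midpoint of the chord, with `d` half the chord. Both endpoints have value `E`, so strong
  -- convexity puts `f c` below `E` by at least `ν₀ * r ^ 2 / 64`.
  set c := x₀ + ((t₁ + t₂) / 2) • b 0 with hcdef
  set d := (r / 2) • b j.succ + ((t₁ - t₂) / 2) • b 0 with hddef
  have hcd : c + d = x₀ + ((r / 2) • b j.succ + t₁ • b 0) := by rw [hcdef, hddef]; module
  have hcd' : c - d = x₀ + ((-(r / 2)) • b j.succ + t₂ • b 0) := by rw [hcdef, hddef]; module
  have hconv := hM.midpoint_convex hx₀r hKx (c := c) (d := d)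
    (by rw [hcd]; exact hnear _ _ hs ht₁) (by rw [hcd']; exact hnear _ _ (by rwa [abs_neg]) ht₂)
  rw [hcd, hcd', h₁, h₂] at hconv
  have hdn : r / 4 ≤ ‖d‖ := by
    have e1 := norm_sub_le_norm_add ((r / 2) • b j.succ) (((t₁ - t₂) / 2) • b 0)
    rw [norm_smul, norm_smul, b.norm_eq_one, b.norm_eq_one, mul_one, mul_one, Real.norm_eq_abs,
      Real.norm_eq_abs, abs_of_pos (by positivity : 0 < r / 2), abs_div, abs_two] at e1
    linarith
  have hdn2 : (r / 4) ^ 2 ≤ ‖d‖ ^ 2 := by gcongr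
  have hmid : |(t₁ + t₂) / 2| ≤ r := by
    rw [abs_div, abs_two]; linarith [abs_add_le t₁ t₂]
  have hcmem : c ∈ closedBall (0 : EuclideanSpace ℝ (Fin (m + 1))) (2 * ‖x₀‖) := by
    have := hnear 0 _ (by rw [abs_zero]; exact hr0.le) hmid
    rw [zero_smul, zero_add] at this
    exact mem_closedBall_zero_iff.2 this
  have hcmem' : x₀ + tc • b 0 ∈ closedBall (0 : EuclideanSpace ℝ (Fin (m + 1))) (2 * ‖x₀‖) := by
    have := hnear 0 _ (by rw [abs_zero]; exact hr0.le) htc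
    rw [zero_smul, zero_add] at this
    exact mem_closedBall_zero_iff.2 this
  have hsub := closedBall_subset_ball (x := (0 : EuclideanSpace ℝ (Fin (m + 1)))) hx₀r
  -- The midpoint and the level point over `y = 0` lie on one normal line, where the gradient is at
  -- most `2 * K * ‖x₀‖`; the drop in value therefore forces a distance between them.
  have hmv := (convex_closedBall (0 : EuclideanSpace ℝ (Fin (m + 1)))
    (2 * ‖x₀‖)).norm_image_sub_le_of_norm_fderiv_le (𝕜 := ℝ) (f := f) (C := K * (2 * ‖x₀‖))
    (fun z hz => hM.diff z (hsub hz))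
    (fun z hz => (hM.norm_fderiv_le (mem_ball_zero_iff.1 (hsub hz))).trans
      (mul_le_mul_of_nonneg_left (mem_closedBall_zero_iff.1 hz) hK)) hcmem' hcmem
  have hdiff : c - (x₀ + tc • b 0) = ((t₁ + t₂ - 2 * tc) / 2) • b 0 := by rw [hcdef]; module
  rw [hc, hdiff, norm_smul, b.norm_eq_one, mul_one, Real.norm_eq_abs, Real.norm_eq_abs,
    abs_div (t₁ + t₂ - 2 * tc), abs_two] at hmv
  have hmv' := (abs_le.1 hmv).1
  set T := |t₁ + t₂ - 2 * tc|
  have hT0 : 0 ≤ T := abs_nonneg _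
  have h1 : ν₀ * r ^ 2 / 64 ≤ K * ‖x₀‖ * T := by
    have := mul_le_mul_of_nonneg_left hdn2 (by positivity : 0 ≤ ν₀ / 2)
    nlinarith
  have h2 : ν₁ * (ν₀ * r ^ 2 / 64) ≤ ν₀ / 4000 * ‖x₀‖ * T := by
    have e1 := mul_le_mul_of_nonneg_left h1 hν₁.le
    have e2 := mul_le_mul_of_nonneg_right hKν (mul_nonneg hx₀.le hT0)
    nlinarith
  have h3 : (50 * ν₁ ^ 2 * r) * (ν₀ * ‖x₀‖) ≤ T * (ν₀ * ‖x₀‖) := by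
    have e : ν₁ * (ν₀ * r ^ 2 / 64) = ν₁ ^ 2 * r * (ν₀ * ‖x₀‖) / 64 := by rw [hr]; ring
    rw [e] at h2
    have : 0 ≤ ν₁ ^ 2 * r * (ν₀ * ‖x₀‖) := by positivity
    nlinarith
  exact le_of_mul_le_mul_right h3 (by positivity)

/-- Arithmetic of the tangential case: `V` and `B` are the sizes of the functional on a tangent
vector and on the normal, `D` the height difference of two level points. Flatness makes `D * B` too
small to cancel `r * V`. -/
theorem tangential_contradiction {m ν₀ ν₁ L r V B D : ℝ} (hm : 0 ≤ m) (hν₀ : 0 < ν₀) (hL : 0 < L)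
    (hr : 0 < r) (hB0 : 0 ≤ B) (hV : ν₀ * L ≤ 2 * (m + 1) * V) (hD : D * (100 * (m + 1)) ≤ r)
    (hB : B < ν₀ * L / 2) (h : r * V ≤ D * B + 4 * (L * r * ν₁ ^ 4))
    (hν : 4000 * (m + 1) * ν₁ ^ 4 ≤ ν₀) : False := by
  have e1 := mul_le_mul_of_nonneg_left hV hr.le
  have e2 := mul_le_mul_of_nonneg_right hD hB0
  have e3 := mul_lt_mul_of_pos_left hB hr
  have e4 := mul_le_mul_of_nonneg_left hν (mul_pos hL hr).le
  have e5 := mul_le_mul_of_nonneg_left h (by linarith : 0 ≤ 2 * (m + 1))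
  have e6 : 0 < L * r * ν₀ := by positivity
  linarith

/-- A nearly linear function with nonzero differential is not small on a patch of a level set. -/
theorem LevelPatch.exists_large_value (hP : LevelPatch f b x₀ r₀ K r g₀)
    (hM : NondegMin f F A r₀ ν₀ K) (hν₀ : 0 < ν₀) {ν₁ : ℝ} (hν₁ : 0 < ν₁) (hν₁' : ν₁ ≤ 1)
    (hx₀ : 0 < ‖x₀‖) (hr : r = ν₁ * ‖x₀‖) (hrx : 14 * (m + 1) * r ≤ ‖x₀‖) (hx₀r : 2 * ‖x₀‖ < r₀)
    (hKx : K * (2 * ‖x₀‖) ≤ ν₀ / 2) (hKν : 4000 * (K * ν₁) ≤ ν₀) (hνν : 4000 * (m + 1) * ν₁ ≤ ν₀)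
    (hm0 : 0 < m) {E : ℝ} {t : (Fin m → ℝ) → ℝ}
    (ht : ∀ y : Fin m → ℝ, ‖y‖ < r → |t y| ≤ r ∧ f (realFrame b x₀ y (t y)) = E)
    {φ : EuclideanSpace ℝ (Fin (m + 1)) → ℝ} {v : EuclideanSpace ℝ (Fin (m + 1)) →L[ℝ] ℝ}
    {L η : ℝ} (hL : 0 < L) (hη : η ≤ ν₁ ^ 4)
    (hφ : ∀ x y, ‖x - x₀‖ ≤ 14 * (m + 1) * r → ‖y - x₀‖ ≤ 14 * (m + 1) * r →
      |φ y - φ x - v (y - x)| ≤ η * L * ‖y - x‖)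
    {u : EuclideanSpace ℝ (Fin (m + 1))} (hu : ‖u‖ = 1) (hv : ν₀ * L ≤ v u) :
    ∃ y : Fin m → ℝ, ‖y‖ < r ∧ L * ‖x₀‖ * ν₁ ^ 5 < |φ (realFrame b x₀ y (t y))| := by
  by_contra! hcon
  have hr0 := hP.r_pos
  have hm : (0 : ℝ) ≤ m := m.cast_nonneg
  have hsmall : ∀ y : Fin m → ℝ, ‖y‖ < r → |φ (realFrame b x₀ y (t y))| ≤ L * r * ν₁ ^ 4 :=
    fun y hy => (hcon y hy).trans_eq (by rw [hr]; ring)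
  have hn0 : ‖(0 : Fin m → ℝ)‖ < r := by rwa [norm_zero]
  have hn1 : ∀ j : Fin m, ‖(Pi.single j (r / 2) : Fin m → ℝ)‖ < r := fun j => by
    rw [Pi.norm_single, Real.norm_of_nonneg (by positivity)]; linarith
  have hn2 : ∀ j : Fin m, ‖(Pi.single j (-(r / 2)) : Fin m → ℝ)‖ < r := fun j => by
    rw [Pi.norm_single, norm_neg, Real.norm_of_nonneg (by positivity)]; linarith
  set xc := realFrame b x₀ 0 (t 0) with hxc
  set x₁ : Fin m → _ := fun j => realFrame b x₀ (Pi.single j (r / 2)) (t (Pi.single j (r / 2)))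
    with hx₁
  set x₂ : Fin m → _ := fun j => realFrame b x₀ (Pi.single j (-(r / 2))) (t (Pi.single j (-(r / 2))))
    with hx₂
  have hxc' : xc = x₀ + t 0 • b 0 := by simp [hxc, realFrame]
  have hx₁' : ∀ j, x₁ j = x₀ + ((r / 2) • b j.succ + t (Pi.single j (r / 2)) • b 0) :=
    fun j => realFrame_single b x₀ j _ _
  have hx₂' : ∀ j, x₂ j = x₀ + ((-(r / 2)) • b j.succ + t (Pi.single j (-(r / 2))) • b 0) :=
    fun j => realFrame_single b x₀ j _ _
  have hlt : ∀ {y : Fin m → ℝ}, ‖y‖ < r → ‖y‖ < 13 * r := fun h => by linarith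
  have kc := hP.norm_realFrame_sub_le (hlt hn0) (ht 0 hn0).1
  have k₁ : ∀ j, ‖x₁ j - x₀‖ ≤ 14 * (m + 1) * r :=
    fun j => hP.norm_realFrame_sub_le (hlt (hn1 j)) (ht _ (hn1 j)).1
  have k₂ : ∀ j, ‖x₂ j - x₀‖ ≤ 14 * (m + 1) * r :=
    fun j => hP.norm_realFrame_sub_le (hlt (hn2 j)) (ht _ (hn2 j)).1
  have d₁ : ∀ j, x₁ j - xc = (r / 2) • b j.succ + (t (Pi.single j (r / 2)) - t 0) • b 0 :=
    fun j => by rw [hx₁', hxc']; module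
  have d₂ : ∀ j, x₂ j - xc = (-(r / 2)) • b j.succ + (t (Pi.single j (-(r / 2))) - t 0) • b 0 :=
    fun j => by rw [hx₂', hxc']; module
  have d₃ : ∀ j, x₁ j - x₂ j =
      r • b j.succ + (t (Pi.single j (r / 2)) - t (Pi.single j (-(r / 2)))) • b 0 :=
    fun j => by rw [hx₁', hx₂']; module
  have hfl : ∀ (a : ℝ) (j : Fin m), fderiv ℝ f x₀ (a • b j.succ) = 0 := fun a j => by
    rw [map_smul, hP.fderiv_tangent, smul_zero]
  have hnl : ∀ (a : ℝ) (j : Fin m), ‖a • b j.succ‖ = |a| := fun a j => by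
    rw [norm_smul, b.norm_eq_one, mul_one, Real.norm_eq_abs]
  have s₁ : ∀ j, |t (Pi.single j (r / 2)) - t 0| * (100 * (m + 1)) ≤ r / 2 := fun j => by
    have := hP.slope_le hM kc (k₁ j) ((ht _ hn0).2.trans (ht _ (hn1 j)).2.symm) (hfl _ _) (d₁ j)
    rwa [hnl, abs_of_pos (by positivity : 0 < r / 2)] at this
  have s₂ : ∀ j, |t (Pi.single j (-(r / 2))) - t 0| * (100 * (m + 1)) ≤ r / 2 := fun j => by
    have := hP.slope_le hM kc (k₂ j) ((ht _ hn0).2.trans (ht _ (hn2 j)).2.symm) (hfl _ _) (d₂ j)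
    rwa [hnl, abs_neg, abs_of_pos (by positivity : 0 < r / 2)] at this
  have s₃ : ∀ j, |t (Pi.single j (r / 2)) - t (Pi.single j (-(r / 2)))| * (100 * (m + 1)) ≤ r :=
    fun j => by
    have := hP.slope_le hM (k₂ j) (k₁ j) ((ht _ (hn2 j)).2.trans (ht _ (hn1 j)).2.symm) (hfl _ _)
      (d₃ j)
    rwa [hnl, abs_of_pos hr0] at this
  have hdrop : ∀ {a c : ℝ}, |a| * (100 * (m + 1)) ≤ c → |a| ≤ c / 100 := fun {a c} h => by
    nlinarith [abs_nonneg a, mul_nonneg hm (abs_nonneg a)]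
  have hnorm : ∀ (a δ c : ℝ) (j : Fin m), |a| ≤ r → |δ| * (100 * (m + 1)) ≤ c → c ≤ r →
      ‖a • b j.succ + δ • b 0‖ ≤ 2 * r := fun a δ c j ha hδ hc => by
    refine (norm_add_le _ _).trans ?_
    rw [hnl, norm_smul, b.norm_eq_one, mul_one, Real.norm_eq_abs]
    linarith [hdrop hδ]
  have hr2 : |r / 2| ≤ r := by rw [abs_of_pos (by positivity)]; linarith
  have hr2' : |-(r / 2)| ≤ r := by rwa [abs_neg]
  have hηL : ∀ q : ℝ, q ≤ 2 * r → 0 ≤ q → η * L * q ≤ 2 * (L * r * ν₁ ^ 4) := fun q hq hq0 => by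
    calc η * L * q ≤ ν₁ ^ 4 * L * (2 * r) := by gcongr
      _ = _ := by ring
  have pc := abs_le.1 (hsmall 0 hn0)
  have p₁ := fun j => abs_le.1 (hsmall _ (hn1 j))
  have p₂ := fun j => abs_le.1 (hsmall _ (hn2 j))
  have hν4 : ν₁ ^ 4 ≤ ν₁ ^ 3 := pow_le_pow_of_le_one hν₁.le hν₁' (by norm_num)
  have hν3 : ν₁ ^ 4 ≤ ν₁ := pow_le_of_le_one hν₁.le hν₁' (by norm_num)
  have hLr : 0 < L * r := by positivity
  -- When the normal component is small, some tangent component is large, and the two opposite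
  -- points differ by `r` in that direction.
  by_cases hβ : |v (b 0)| < ν₀ * L / 2
  · obtain ⟨j, hj⟩ := exists_tangent_ge (by positivity) hu hv hβ
    have q := hφ _ _ (k₂ j) (k₁ j)
    have q' := q.trans (hηL _ (by rw [d₃]; exact hnorm _ _ _ j (by rw [abs_of_pos hr0]) (s₃ j) le_rfl)
      (norm_nonneg _))
    rw [d₃, map_add, map_smul, map_smul, smul_eq_mul, smul_eq_mul] at q'
    have q'' := abs_le.1 q'
    have e1 : |r * v (b j.succ)| ≤ |(t (Pi.single j (r / 2)) - t (Pi.single j (-(r / 2)))) * v (b 0)|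
        + 4 * (L * r * ν₁ ^ 4) := by
      have e := abs_sub_abs_le_abs_sub (r * v (b j.succ))
        (-((t (Pi.single j (r / 2)) - t (Pi.single j (-(r / 2)))) * v (b 0)))
      rw [abs_neg, sub_neg_eq_add] at e
      have e' : |r * v (b j.succ) + (t (Pi.single j (r / 2)) - t (Pi.single j (-(r / 2)))) * v (b 0)|
          ≤ 4 * (L * r * ν₁ ^ 4) :=
        abs_le.2 ⟨by linarith [(p₁ j).1, (p₁ j).2, (p₂ j).1, (p₂ j).2, q''.1, q''.2],
          by linarith [(p₁ j).1, (p₁ j).2, (p₂ j).1, (p₂ j).2, q''.1, q''.2]⟩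
      linarith
    rw [abs_mul, abs_of_pos hr0, abs_mul] at e1
    exact tangential_contradiction hm hν₀ hL hr0 (abs_nonneg _) hj (s₃ j) hβ e1
      ((mul_le_mul_of_nonneg_left hν3 (by positivity)).trans hνν)
  · rw [not_lt] at hβ
    set j : Fin m := ⟨0, hm0⟩
    have q₁ := (hφ _ _ kc (k₁ j)).trans (hηL _ (by
      rw [d₁]; exact hnorm _ _ _ j hr2 (s₁ j) (by linarith)) (norm_nonneg _))
    have q₂ := (hφ _ _ kc (k₂ j)).trans (hηL _ (by
      rw [d₂]; exact hnorm _ _ _ j hr2' (s₂ j) (by linarith)) (norm_nonneg _))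
    rw [d₁, map_add, map_smul, map_smul, smul_eq_mul, smul_eq_mul] at q₁
    rw [d₂, map_add, map_smul, map_smul, smul_eq_mul, smul_eq_mul] at q₂
    have q₁' := abs_le.1 q₁
    have q₂' := abs_le.1 q₂
    -- In the second difference the tangential terms cancel, whatever their size. The 8 collects
    -- four small values, the centre counted twice, and two linearization errors of weight 2.
    have e1 : |(t (Pi.single j (r / 2)) + t (Pi.single j (-(r / 2))) - 2 * t 0) * v (b 0)| ≤
        8 * (L * r * ν₁ ^ 4) :=
      abs_le.2 ⟨by linarith [(p₁ j).1, (p₁ j).2, (p₂ j).1, (p₂ j).2, pc.1, pc.2, q₁'.1, q₁'.2,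
        q₂'.1, q₂'.2], by linarith [(p₁ j).1, (p₁ j).2, (p₂ j).1, (p₂ j).2, pc.1, pc.2, q₁'.1,
        q₁'.2, q₂'.1, q₂'.2]⟩
    have e2 := hP.second_difference_ge hM hν₀ hν₁ hx₀ hr hrx hx₀r hKx hKν j (ht 0 hn0).1
      (ht _ (hn1 j)).1 (ht _ (hn2 j)).1 (E := E) (by rw [← hxc']; exact (ht 0 hn0).2)
      (by rw [← hx₁']; exact (ht _ (hn1 j)).2) (by rw [← hx₂']; exact (ht _ (hn2 j)).2)
      (by linarith [hdrop (s₃ j)])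
    rw [abs_mul] at e1
    have e3 : 50 * ν₁ ^ 2 * r * (ν₀ * L / 2) ≤ 8 * (L * r * ν₁ ^ 4) :=
      (mul_le_mul e2 hβ (by positivity) (abs_nonneg _)).trans e1
    have e4 : ν₁ ≤ ν₀ := by nlinarith
    have e5 : L * r * ν₁ ^ 4 ≤ L * r * (ν₁ ^ 2 * ν₀) := by
      refine mul_le_mul_of_nonneg_left (hν4.trans ?_) hLr.le
      rw [pow_succ]; gcongr
    have e6 : 0 < L * r * (ν₁ ^ 2 * ν₀) := by positivity
    have e7 : 50 * ν₁ ^ 2 * r * (ν₀ * L / 2) = 25 * (L * r * (ν₁ ^ 2 * ν₀)) := by ring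
    linarith

end Nondegeneracy

/-! ### Cartan estimate in the required form, and parameter relations -/

/-- The Cartan estimate, with the lower bound at one point given as a power. -/
theorem volume_logAbs_le {m : ℕ} (hm : 0 < m) {r ν₁ a : ℝ} (hr : 0 < r) (hν₁ : 0 < ν₁)
    (hν₁' : ν₁ ≤ 1 / 4) (ha : 0 < a) (ha' : a ≤ 1 / 4) {φ : (Fin m → ℂ) → ℂ} {u : (Fin m → ℝ) → ℝ}
    (hφ : DifferentiableOn ℂ φ (ball 0 (13 * r)))
    (hB : ∀ w ∈ ball (0 : Fin m → ℂ) (13 * r), ‖φ w‖ ≤ 1)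
    (hu : ∀ y : Fin m → ℝ, ‖y‖ < r → φ (fun i => (y i : ℂ)) = u y)
    (hy : ∃ y : Fin m → ℝ, ‖y‖ < r ∧ a ^ 5 < |u y|) {H : ℝ} (hH : 1 ≤ H) :
    MeasureTheory.volume {y : Fin m → ℝ | ‖y‖ < r ∧
        logAbs (u y) ≤ ((5 * 10 ^ m * Real.log a * H : ℝ) : EReal)} ≤
      ENNReal.ofReal (((ν₁ ^ 2)⁻¹ * r) ^ m *
        Real.exp (-(H ^ (1 / (((m + 1 : ℕ) : ℝ) - 1))))) := by
  have hm' : (0 : ℝ) < m := by exact_mod_cast hm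
  have hexp : (((m + 1 : ℕ) : ℝ) - 1) = m := by push_cast; ring
  rw [hexp]
  -- With this `h` and `μ = -5 * log a`, the Cartan threshold `-(10 * h) ^ m * μ` is exactly `5 * 10
  -- ^ m * log a * H`.
  set h := H ^ (1 / (m : ℝ)) with hh
  have hh1 : 1 ≤ h := Real.one_le_rpow hH (by positivity)
  have hhm : h ^ m = H := by
    rw [hh, one_div, Real.rpow_inv_natCast_pow (by linarith) hm.ne']
  have hlog : Real.log a ≤ -1 := by
    have h1 : a ≤ Real.exp (-1) := by
      rw [Real.exp_neg]
      refine ha'.trans ?_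
      rw [one_div]
      exact inv_anti₀ (Real.exp_pos 1) (by linarith [Real.exp_one_lt_d9])
    have h2 := Real.log_le_log ha h1
    rwa [Real.log_exp] at h2
  have hexpμ : Real.exp (-(-(5 * Real.log a))) = a ^ 5 := by
    rw [neg_neg, mul_comm, Real.exp_mul, Real.exp_log ha]
    norm_cast
  obtain ⟨y, hyr, hya⟩ := hy
  have hmain := volume_small_values_pi_le hr hh1 m φ (-(5 * Real.log a)) (by linarith) hφ hB
    ⟨y, hyr, by rwa [hexpμ, hu y hyr, Complex.norm_real]⟩
  refine (MeasureTheory.measure_mono ?_).trans (hmain.trans (ENNReal.ofReal_le_ofReal ?_))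
  · rintro z ⟨hz, hz'⟩
    rw [logAbs_le_iff] at hz'
    refine ⟨hz, ?_⟩
    rw [hu z hz, Complex.norm_real, Real.norm_eq_abs]
    refine hz'.trans_eq ?_
    rw [mul_pow, hhm]
    congr 1; ring
  · refine mul_le_mul_of_nonneg_right ?_ (Real.exp_pos _).le
    rw [mul_pow, mul_pow, ← mul_assoc]
    refine mul_le_mul_of_nonneg_right ?_ (by positivity)
    -- The dimensional factor `m * 2 ^ m ≤ 4 ^ m` is absorbed by the power of `ν₁⁻²` allowed in the
    -- bound.
    have h1 : (m : ℝ) ≤ 2 ^ m := by exact_mod_cast Nat.lt_two_pow_self.le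
    have h2 : (4 : ℝ) ≤ (ν₁ ^ 2)⁻¹ := by
      rw [le_inv_comm₀ (by norm_num) (by positivity)]
      nlinarith
    calc (m : ℝ) * 2 ^ m ≤ 2 ^ m * 2 ^ m := by gcongr
      _ = 4 ^ m := by rw [← mul_pow]; norm_num
      _ ≤ _ := by gcongr

/-- Smallness relations between the parameters. -/
structure SmallParams (m : ℕ) (x₀ : EuclideanSpace ℝ (Fin (m + 1))) (r₀ ν₀ ν₁ K r : ℝ) : Prop where
  dim_pos : 0 < m
  ν₀_pos : 0 < ν₀
  ν₀_lt : ν₀ < 1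
  ν₁_pos : 0 < ν₁
  ν₁_le : ν₁ ≤ 1 / 4000
  K_nonneg : 0 ≤ K
  norm_pos : 0 < ‖x₀‖
  norm_le : ‖x₀‖ ≤ ν₁ ^ 6
  norm_lt : 4000 * ‖x₀‖ < r₀
  r_eq : r = ν₁ * ‖x₀‖
  r_le : r ≤ ν₁
  patch_lt : 14 * (m + 1) * r < ‖x₀‖ / 2
  K_norm_le : K * (2 * ‖x₀‖) ≤ ν₀ / 2
  K_ν₁_le : 4000 * (K * ν₁) ≤ ν₀
  K_sq_le : 4000 * (K * ν₁ ^ 2) ≤ 1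
  m_ν₁_le : 4000 * (m + 1) * ν₁ ≤ ν₀
  error_le : K * (3 * ν₁ ^ 6) ≤ ν₁ ^ 4

theorem smallParams_of_lt {m : ℕ} (hm : 0 < m) {x₀ : EuclideanSpace ℝ (Fin (m + 1))}
    {r₀ ν₀ ν₁ K r : ℝ} (hr₀ : 0 < r₀) (hr₀' : r₀ < 1) (hν₀ : 0 < ν₀) (hν₀' : ν₀ < 1) (hν₁ : 0 < ν₁)
    (hK : 1 ≤ K) (hKν : 4000 * (m + 1) ^ 2 * (K * ν₁) ≤ ν₀) (hx₀ : 0 < ‖x₀‖)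
    (hx₀' : ‖x₀‖ < r₀ * ν₁ ^ 10) (hr : r = ν₁ * ‖x₀‖) : SmallParams m x₀ r₀ ν₀ ν₁ K r := by
  have hm1 : (1 : ℝ) ≤ m := by exact_mod_cast hm
  have hK0 : 0 ≤ K := by linarith
  have hKν1 : 0 < K * ν₁ := by positivity
  have hmm : (m : ℝ) + 1 ≤ (m + 1) ^ 2 := by nlinarith
  have hmK : 4000 * (m + 1) * (K * ν₁) ≤ ν₀ := by nlinarith
  have hKν' : 4000 * (K * ν₁) ≤ ν₀ := by nlinarith
  have hν₁K : ν₁ ≤ K * ν₁ := by nlinarith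
  have hmν : 4000 * (m + 1) * ν₁ ≤ ν₀ := by nlinarith
  have hν₁' : ν₁ ≤ 1 / 4000 := by linarith
  have hν₁1 : ν₁ ≤ 1 := by linarith
  have hp10 : ν₁ ^ 10 ≤ ν₁ ^ 6 := pow_le_pow_of_le_one hν₁.le hν₁1 (by norm_num)
  have hp6 : ν₁ ^ 6 ≤ ν₁ := pow_le_of_le_one hν₁.le hν₁1 (by norm_num)
  have hρ : r₀ * ν₁ ^ 10 ≤ ν₁ ^ 6 := by nlinarith [pow_pos hν₁ 10]
  have hρr : r₀ * ν₁ ^ 10 ≤ r₀ / 4000 := by nlinarith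
  have hxν : ‖x₀‖ ≤ ν₁ ^ 6 := hx₀'.le.trans hρ
  have hKη : K * (3 * ν₁ ^ 6) ≤ ν₁ ^ 4 := by
    have : K * (3 * ν₁ ^ 6) = 3 * (K * ν₁) * ν₁ * ν₁ ^ 4 := by ring
    rw [this]
    refine mul_le_of_le_one_left (by positivity) ?_
    nlinarith
  exact ⟨hm, hν₀, hν₀', hν₁, hν₁', hK0, hx₀, hxν, by linarith, hr, by rw [hr]; nlinarith,
    by rw [hr]; nlinarith, by nlinarith, hKν', by nlinarith, hmν, hKη⟩

/-! ### The two small-value estimates on level sets -/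

section Main

variable {m : ℕ} {f : EuclideanSpace ℝ (Fin (m + 1)) → ℝ} {F : EuclideanSpace ℂ (Fin (m + 1)) → ℂ}
  {A : EuclideanSpace ℝ (Fin (m + 1)) →L[ℝ] EuclideanSpace ℝ (Fin (m + 1)) →L[ℝ] ℝ}
  {b : OrthonormalBasis (Fin (m + 1)) ℝ (EuclideanSpace ℝ (Fin (m + 1)))}
  {x₀ : EuclideanSpace ℝ (Fin (m + 1))} {r₀ ν₀ K r g₀ : ℝ}

/-- The increments of `f` along a fixed shift are nearly linear. -/
theorem NondegMin.shift_near_linear (hM : NondegMin f F A r₀ ν₀ K)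
    {h x y : EuclideanSpace ℝ (Fin (m + 1))} {ℓ R : ℝ} (hR : ‖x₀‖ + ℓ + ‖h‖ ≤ R)
    (hRr : R < r₀) (hx : ‖x - x₀‖ ≤ ℓ) (hy : ‖y - x₀‖ ≤ ℓ) :
    |(f (y + h) - f y) - (f (x + h) - f x) - A h (y - x)| ≤ K * R * ‖h‖ * ‖y - x‖ := by
  have hnear : ∀ z, ‖z - x₀‖ ≤ ℓ → ‖z‖ ≤ R ∧ ‖z + h‖ ≤ R := fun z hz => by
    have e1 := norm_sub_norm_le z x₀
    have e2 := norm_add_le z h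
    constructor <;> linarith [norm_nonneg h]
  -- The increment has differential `fderiv ℝ f (z + h) - fderiv ℝ f z`, which is `A h` up to `K * R
  -- * ‖h‖`. The error is thus proportional to `‖h‖`, as the linear part is.
  refine (convex_closedBall x₀ ℓ).norm_image_sub_le_of_norm_hasFDerivWithin_le'
    (f := fun z => f (z + h) - f z) (f' := fun z => fderiv ℝ f (z + h) - fderiv ℝ f z)
    (fun z hz => ?_) (fun z hz => ?_) (mem_closedBall_iff_norm.2 hx) (mem_closedBall_iff_norm.2 hy)
  · obtain ⟨h1, h2⟩ := hnear z (mem_closedBall_iff_norm.1 hz)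
    have e1 := (hM.diff z (mem_ball_zero_iff.2 (h1.trans_lt hRr))).hasFDerivAt
    have e2 := (hM.diff (z + h) (mem_ball_zero_iff.2 (h2.trans_lt hRr))).hasFDerivAt
    exact (((hasFDerivAt_comp_add_right h).2 e2).sub e1).hasFDerivWithinAt
  · obtain ⟨h1, h2⟩ := hnear z (mem_closedBall_iff_norm.1 hz)
    have := hM.hess_approx R hRr (z + h) z h2 h1
    rwa [add_sub_cancel_left] at this

/-- Value and gradient vanish at the origin. The bound serves to make the shifted function at most
1, the normalization of the Cartan estimate. -/
theorem NondegMin.norm_le_sq (hM : NondegMin f F A r₀ ν₀ K) (hK : 0 ≤ K)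
    {z : EuclideanSpace ℂ (Fin (m + 1))} (hz : ‖z‖ < r₀) : ‖F z‖ ≤ K * ‖z‖ ^ 2 := by
  have hr₀ : 0 < r₀ := (norm_nonneg z).trans_lt hz
  have h := norm_sub_sub_fderiv_le (b := 0) (x := 0) (y := z) (ℓ := ‖z‖) hK
    (fun w hw => (hM.analytic w hw).differentiableAt) hM.lip (mem_ball_self hr₀)
    (mem_ball_self hr₀) (mem_ball_zero_iff.2 hz) (by simp) (by simp)
  have h0 := hM.extends_real 0 (mem_ball_self hr₀)
  rw [toComplexVec_zero, hM.map_zero, Complex.ofReal_zero] at h0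
  rw [h0, hM.fderiv_complex_zero] at h
  simp only [sub_zero, zero_apply] at h
  linarith

theorem NondegMin.norm_fderiv_complex_le (hM : NondegMin f F A r₀ ν₀ K)
    {z : EuclideanSpace ℂ (Fin (m + 1))} (hz : ‖z‖ < r₀) : ‖fderiv ℂ F z‖ ≤ K * ‖z‖ := by
  have h := hM.lip z (mem_ball_zero_iff.2 hz) 0 (mem_ball_self ((norm_nonneg z).trans_lt hz))
  rwa [hM.fderiv_complex_zero, sub_zero, sub_zero] at h

theorem contDiff_realFrame (b : OrthonormalBasis (Fin (m + 1)) ℝ (EuclideanSpace ℝ (Fin (m + 1))))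
    (x₀ : EuclideanSpace ℝ (Fin (m + 1))) :
    ContDiff ℝ ⊤ fun p : (Fin m → ℝ) × ℝ => realFrame b x₀ p.1 p.2 := by
  unfold realFrame
  fun_prop

theorem complexBox_subset_largeBox (m : ℕ) {r : ℝ} (hr : 0 < r) (E₀ : ℝ) :
    complexBox m r E₀ ⊆ largeBox m r E₀ := fun _ hp => ⟨hp.1.trans (by linarith), hp.2⟩

theorem ofReal_mem_complexBox {m : ℕ} {r E₀ : ℝ} (hr : 0 < r) {p : (Fin m → ℝ) × ℝ}
    (hp : p ∈ realBox m r E₀) :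
    ((fun i => (p.1 i : ℂ)), (p.2 : ℂ)) ∈ complexBox m r E₀ := by
  refine ⟨norm_ofReal_pi_lt hr hp.1, ?_⟩
  change ‖(p.2 : ℂ) - (E₀ : ℂ)‖ < r ^ 2
  rw [← Complex.ofReal_sub, Complex.norm_real]
  exact hp.2

/-- The real part of a holomorphic function, restricted to real arguments, is real-analytic. -/
theorem analyticOnNhd_re_ofReal {m : ℕ} {r E₀ : ℝ} (hr : 0 < r) {T : (Fin m → ℂ) × ℂ → ℂ}
    (hT : AnalyticOnNhd ℂ T (complexBox m r E₀)) :
    AnalyticOnNhd ℝ (fun p : (Fin m → ℝ) × ℝ => (T (fun i => (p.1 i : ℂ), (p.2 : ℂ))).re)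
      (realBox m r E₀) := by
  intro p hp
  set ι : (Fin m → ℝ) × ℝ →L[ℝ] (Fin m → ℂ) × ℂ :=
    ((ContinuousLinearMap.pi fun i => Complex.ofRealCLM.comp (ContinuousLinearMap.proj i)).prodMap
      Complex.ofRealCLM) with hι
  have h1 : AnalyticAt ℝ T (ι p) := (hT _ (ofReal_mem_complexBox hr hp)).restrictScalars
  exact (Complex.reCLM.analyticAt _).comp (h1.comp (ι.analyticAt p))

/-- Small values of `f` on shifts of a level set. -/
theorem LevelPatch.volume_shift_le {ν₁ : ℝ} (hS : SmallParams m x₀ r₀ ν₀ ν₁ K r)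
    (hP : LevelPatch f b x₀ r₀ K r g₀) (hM : NondegMin f F A r₀ ν₀ K) {E : ℝ}
    {W : (Fin m → ℂ) → EuclideanSpace ℂ (Fin (m + 1))} {t : (Fin m → ℝ) → ℝ}
    (hW : AnalyticOnNhd ℂ W (ball 0 (13 * r)))
    (hWn : ∀ w ∈ ball (0 : Fin m → ℂ) (13 * r), ‖W w‖ ≤ 2 * ‖x₀‖)
    (hreal : ∀ y : Fin m → ℝ, ‖y‖ < r →
      W (fun i => (y i : ℂ)) = toComplexVec (realFrame b x₀ y (t y)))
    (hroot : ∀ y : Fin m → ℝ, ‖y‖ < r → |t y| ≤ r ∧ f (realFrame b x₀ y (t y)) = E)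
    (hE : |E - f x₀| < r ^ 2) {h : EuclideanSpace ℝ (Fin (m + 1))} (hh : 0 < ‖h‖)
    (hhν : ‖h‖ ≤ ν₁ ^ 6) (hhr : 4000 * ‖h‖ < r₀) {H : ℝ} (hH : 1 ≤ H) :
    MeasureTheory.volume {y : Fin m → ℝ | ‖y‖ < r ∧
        logAbs (f (realFrame b x₀ y (t y) + h) - E) ≤
          ((5 * 10 ^ m * Real.log (‖h‖ * ‖x₀‖) * H : ℝ) : EReal)} ≤
      ENNReal.ofReal (((ν₁ ^ 2)⁻¹ * r) ^ m *
        Real.exp (-(H ^ (1 / (((m + 1 : ℕ) : ℝ) - 1))))) := by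
  have hrpos := hP.r_pos
  have hm := hS.dim_pos
  have hν₁ := hS.ν₁_pos
  have hν₁' := hS.ν₁_le
  have hK0 := hS.K_nonneg
  have hx₀ := hS.norm_pos
  have hxν := hS.norm_le
  have hr := hS.r_eq
  have hr1 := hS.r_le
  have hℓ := hS.patch_lt
  have hKη := hS.error_le
  have hν₁1 : ν₁ ≤ 1 := by linarith
  have hp6 : ν₁ ^ 6 ≤ ν₁ := pow_le_of_le_one hν₁.le hν₁1 (by norm_num)
  have hx₀r : 2 * ‖x₀‖ < r₀ := by linarith [hS.norm_lt]
  have hin : ∀ w ∈ ball (0 : Fin m → ℂ) (13 * r),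
      ‖W w + toComplexVec h‖ ≤ 2 * ‖x₀‖ + ‖h‖ := by
    intro w hw
    refine (norm_add_le _ _).trans ?_
    rw [norm_toComplexVec]
    linarith [hWn w hw]
  have hin' : 2 * ‖x₀‖ + ‖h‖ < r₀ := by linarith [hS.norm_lt]
  have ha4 : ‖h‖ * ‖x₀‖ ≤ ν₁ ^ 2 := by
    have h1 : ‖h‖ * ‖x₀‖ ≤ ν₁ ^ 6 * ν₁ ^ 6 := mul_le_mul hhν hxν hx₀.le (by positivity)
    have h2 : ν₁ ^ 6 * ν₁ ^ 6 ≤ ν₁ * ν₁ := by gcongr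
    linarith [sq ν₁]
  refine volume_logAbs_le hm hrpos hν₁ (by linarith) (a := ‖h‖ * ‖x₀‖)
    (φ := fun w => F (W w + toComplexVec h) - E)
    (u := fun y => f (realFrame b x₀ y (t y) + h) - E) (by positivity)
    (by nlinarith) ?_ ?_ ?_ ?_ hH
  · intro w hw
    refine AnalyticAt.differentiableAt ?_ |>.differentiableWithinAt
    exact (AnalyticAt.comp (f := fun w => W w + toComplexVec h)
      (hM.analytic _ (mem_ball_zero_iff.2 ((hin w hw).trans_lt hin')))
      ((hW w hw).add analyticAt_const)).sub analyticAt_const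
  · intro w hw
    have h1 := hM.norm_le_sq hK0 ((hin w hw).trans_lt hin')
    have h2 := hM.norm_le_sq hK0 (z := toComplexVec x₀) (by rw [norm_toComplexVec]; linarith)
    rw [norm_toComplexVec, hM.extends_real x₀ hP.base_mem, Complex.norm_real,
      Real.norm_eq_abs] at h2
    have h3 := norm_sub_le (F (W w + toComplexVec h)) (E : ℂ)
    rw [Complex.norm_real, Real.norm_eq_abs] at h3
    have h4 : |E| ≤ |E - f x₀| + |f x₀| := by
      simpa using abs_add_le (E - f x₀) (f x₀)
    have h5 : ‖W w + toComplexVec h‖ ^ 2 ≤ (3 * ν₁) ^ 2 := by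
      have := hin w hw
      gcongr
      linarith
    have h6 : ‖x₀‖ ^ 2 ≤ ν₁ ^ 2 := by gcongr; linarith
    have h7 : r ^ 2 ≤ ν₁ ^ 2 := by gcongr
    have h8 := mul_le_mul_of_nonneg_left h5 hK0
    have h9 := mul_le_mul_of_nonneg_left h6 hK0
    have h10 : K * ν₁ ^ 2 ≤ 1 / 4000 := by linarith [hS.K_sq_le]
    have h11 : ν₁ ^ 2 ≤ 1 / 4000 := by nlinarith
    linarith
  · intro y hy
    have hyC : (fun i => (y i : ℂ)) ∈ ball (0 : Fin m → ℂ) (13 * r) :=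
      mem_ball_zero_iff.2 (norm_ofReal_pi_lt (by positivity) (by linarith))
    have h1 := hin _ hyC
    rw [hreal y hy, ← toComplexVec_add, norm_toComplexVec] at h1
    rw [hreal y hy, ← toComplexVec_add,
      hM.extends_real _ (mem_ball_zero_iff.2 (h1.trans_lt hin')), Complex.ofReal_sub]
  -- The functional `A h` is tested on `h / ‖h‖`. On the level set `f x = E`, so the increment is
  -- the function being estimated.
  · obtain ⟨y, hy, hlarge⟩ := hP.exists_large_value hM hS.ν₀_pos hν₁ hν₁1 hx₀ hr
      (by linarith) hx₀r hS.K_norm_le hS.K_ν₁_le hS.m_ν₁_le hm hroot (φ := fun x => f (x + h) - f x) (v := A h) (L := ‖h‖)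
      (η := K * (3 * ν₁ ^ 6)) hh hKη
      (fun x y hx hy => by
        have h1 := hM.shift_near_linear (x₀ := x₀) (h := h) (ℓ := 14 * (m + 1) * r) (R := 2 * ‖x₀‖ + ‖h‖) (by linarith) hin'
          hx hy
        refine h1.trans ?_
        gcongr
        linarith)
      (u := ‖h‖⁻¹ • h) (by rw [norm_smul, norm_inv, norm_norm, inv_mul_cancel₀ hh.ne']) (by
        rw [map_smul, smul_eq_mul, ← div_eq_inv_mul, le_div_iff₀ hh]
        linarith [hM.hess_pos h])
    refine ⟨y, hy, lt_of_le_of_lt ?_ (by rwa [(hroot y hy).2] at hlarge)⟩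
    -- The fifth power absorbs `ν₁ ^ 5`: both norms are small compared with `ν₁`, so no logarithm of
    -- `ν₁` survives in the threshold.
    calc (‖h‖ * ‖x₀‖) ^ 5 = ‖h‖ * ‖x₀‖ * (‖h‖ * ‖x₀‖) ^ 4 := by ring
      _ ≤ ‖h‖ * ‖x₀‖ * (ν₁ ^ 2) ^ 4 := by gcongr
      _ ≤ ‖h‖ * ‖x₀‖ * ν₁ ^ 5 := by
          refine mul_le_mul_of_nonneg_left ?_ (by positivity)
          rw [← pow_mul]
          exact pow_le_pow_of_le_one hν₁.le hν₁1 (by norm_num)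

/-- Small values of directional derivatives of `f` on a level set. -/
theorem LevelPatch.volume_derivative_le {ν₁ : ℝ} (hS : SmallParams m x₀ r₀ ν₀ ν₁ K r)
    (hP : LevelPatch f b x₀ r₀ K r g₀) (hM : NondegMin f F A r₀ ν₀ K) {E : ℝ}
    {W : (Fin m → ℂ) → EuclideanSpace ℂ (Fin (m + 1))} {t : (Fin m → ℝ) → ℝ}
    (hW : AnalyticOnNhd ℂ W (ball 0 (13 * r)))
    (hWn : ∀ w ∈ ball (0 : Fin m → ℂ) (13 * r), ‖W w‖ ≤ 2 * ‖x₀‖)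
    (hreal : ∀ y : Fin m → ℝ, ‖y‖ < r →
      W (fun i => (y i : ℂ)) = toComplexVec (realFrame b x₀ y (t y)))
    (hroot : ∀ y : Fin m → ℝ, ‖y‖ < r → |t y| ≤ r ∧ f (realFrame b x₀ y (t y)) = E)
    {h₀ : EuclideanSpace ℝ (Fin (m + 1))} (hh₀ : ‖h₀‖ = 1) {H : ℝ} (hH : 1 ≤ H) :
    MeasureTheory.volume {y : Fin m → ℝ | ‖y‖ < r ∧
        logAbs (inner ℝ (gradient f (realFrame b x₀ y (t y))) h₀) ≤
          ((5 * 10 ^ m * Real.log (ν₁ * ‖x₀‖) * H : ℝ) : EReal)} ≤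
      ENNReal.ofReal (((ν₁ ^ 2)⁻¹ * r) ^ m *
        Real.exp (-(H ^ (1 / (((m + 1 : ℕ) : ℝ) - 1))))) := by
  have hrpos := hP.r_pos
  have hm := hS.dim_pos
  have hν₁ := hS.ν₁_pos
  have hν₁' := hS.ν₁_le
  have hK0 := hS.K_nonneg
  have hx₀ := hS.norm_pos
  have hxν := hS.norm_le
  have hr := hS.r_eq
  have hr1 := hS.r_le
  have hℓ := hS.patch_lt
  have hKη := hS.error_le
  have hν₁1 : ν₁ ≤ 1 := by linarith
  have hp6 : ν₁ ^ 6 ≤ ν₁ := pow_le_of_le_one hν₁.le hν₁1 (by norm_num)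
  have hx₀r : 2 * ‖x₀‖ < r₀ := by linarith [hS.norm_lt]
  have hrealnorm : ∀ y : Fin m → ℝ, ‖y‖ < r → ‖realFrame b x₀ y (t y)‖ ≤ 2 * ‖x₀‖ := by
    intro y hy
    have h1 := norm_sub_norm_le (realFrame b x₀ y (t y)) x₀
    have h2 := hP.norm_realFrame_sub_le (by linarith : ‖y‖ < 13 * r) (hroot y hy).1
    linarith
  have hinner : ∀ x, inner ℝ (gradient f x) h₀ = fderiv ℝ f x h₀ := fun x => by
    rw [← InnerProductSpace.toDual_apply_apply, toDual_gradient]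
  simp only [hinner]
  have hin : ∀ w ∈ ball (0 : Fin m → ℂ) (13 * r),
      W w ∈ ball (0 : EuclideanSpace ℂ (Fin (m + 1))) r₀ :=
    fun w hw => mem_ball_zero_iff.2 ((hWn w hw).trans_lt hx₀r)
  refine volume_logAbs_le hm hrpos hν₁ (by linarith) (a := ν₁ * ‖x₀‖)
    (φ := fun w => fderiv ℂ F (W w) (toComplexVec h₀))
    (u := fun y => fderiv ℝ f (realFrame b x₀ y (t y)) h₀) (by positivity)
    (by rw [← hr]; linarith) ?_ ?_ ?_ ?_ hH
  · intro w hw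
    refine DifferentiableAt.differentiableWithinAt ?_
    exact (((hM.analytic _ (hin w hw)).fderiv.differentiableAt.comp w
      (hW w hw).differentiableAt)).clm_apply (differentiableAt_const _)
  · intro w hw
    refine ((fderiv ℂ F _).le_opNorm _).trans ?_
    rw [norm_toComplexVec, hh₀, mul_one]
    refine (hM.norm_fderiv_complex_le (mem_ball_zero_iff.1 (hin w hw))).trans ?_
    have := mul_le_mul_of_nonneg_left (hWn w hw) hK0
    linarith [hS.K_norm_le, hS.ν₀_lt]
  · intro y hy
    rw [hreal y hy, hM.fderiv_extends _
      (mem_ball_zero_iff.2 ((hrealnorm y hy).trans_lt hx₀r))]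
  -- Here the linear part is `A · h₀`, tested on `h₀` itself.
  · obtain ⟨y, hy, hlarge⟩ := hP.exists_large_value hM hS.ν₀_pos hν₁ hν₁1 hx₀ hr
      (by linarith) hx₀r hS.K_norm_le hS.K_ν₁_le hS.m_ν₁_le hm hroot (φ := fun x => fderiv ℝ f x h₀) (v := A.flip h₀) (L := 1)
      (η := K * (3 * ν₁ ^ 6)) one_pos hKη
      (fun x y hx hy => by
        have e1 := norm_sub_norm_le x x₀
        have e2 := norm_sub_norm_le y x₀
        have h1 := ContinuousLinearMap.le_of_opNorm_le _ (hM.hess_approx (2 * ‖x₀‖) hx₀r y x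
          (by linarith) (by linarith)) h₀
        rw [hh₀, mul_one, Real.norm_eq_abs] at h1
        refine h1.trans ?_
        rw [mul_one]
        gcongr
        linarith)
      (u := h₀) hh₀ (by
        have := hM.hess_pos h₀
        rw [hh₀] at this
        rw [ContinuousLinearMap.flip_apply]
        linarith)
    refine ⟨y, hy, lt_of_le_of_lt ?_ hlarge⟩
    rw [one_mul, mul_pow, mul_comm]
    refine mul_le_mul_of_nonneg_right ?_ (by positivity)
    exact pow_le_of_le_one hx₀.le (by linarith) (by norm_num)

/-- Parametrization of the level sets near `x₀`, with estimates for nearly degenerate values. -/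
theorem NondegMin.exists_level_parametrization (hm : 0 < m) (hM : NondegMin f F A r₀ ν₀ K) {ν₁ : ℝ}
    (hr₀ : 0 < r₀) (hr₀' : r₀ < 1) (hν₀ : 0 < ν₀) (hν₀' : ν₀ < 1) (hν₁ : 0 < ν₁) (hK : 1 ≤ K)
    (hKν : 4000 * (m + 1) ^ 2 * (K * ν₁) ≤ ν₀) (hx₀ : 0 < ‖x₀‖) (hx₀' : ‖x₀‖ < r₀ * ν₁ ^ 10)
    (hr : r = ν₁ * ‖x₀‖) :
    ∃ x : (Fin m → ℝ) × ℝ → EuclideanSpace ℝ (Fin (m + 1)),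
      AnalyticOnNhd ℝ x (realBox m r (f x₀)) ∧
      (∀ p ∈ realBox m r (f x₀), f (x p) = p.2) ∧
      x (0, f x₀) = x₀ ∧
      (∃ X : (Fin m → ℂ) × ℂ → EuclideanSpace ℂ (Fin (m + 1)),
        AnalyticOnNhd ℂ X (complexBox m r (f x₀)) ∧
        (∀ p ∈ realBox m r (f x₀),
          X (fun i => (p.1 i : ℂ), (p.2 : ℂ)) = toComplexVec (x p)) ∧
        (∀ q ∈ complexBox m r (f x₀), ‖X q - toComplexVec x₀‖ < ‖x₀‖ / 2)) ∧
      (∀ E : ℝ, |E - f x₀| < r ^ 2 →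
        ∀ h : EuclideanSpace ℝ (Fin (m + 1)), 0 < ‖h‖ → ‖h‖ < r₀ * ν₁ ^ 10 →
        ∀ H : ℝ, 1 ≤ H →
          MeasureTheory.volume {y : Fin m → ℝ | ‖y‖ < r ∧
              logAbs (f (x (y, E) + h) - E) ≤
                ((5 * 10 ^ m * Real.log (‖h‖ * ‖x₀‖) * H : ℝ) : EReal)} ≤
            ENNReal.ofReal (((ν₁ ^ 2)⁻¹ * r) ^ m *
              Real.exp (-(H ^ (1 / (((m + 1 : ℕ) : ℝ) - 1)))))) ∧
      (∀ E : ℝ, |E - f x₀| < r ^ 2 →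
        ∀ h₀ : EuclideanSpace ℝ (Fin (m + 1)), ‖h₀‖ = 1 →
        ∀ H : ℝ, 1 ≤ H →
          MeasureTheory.volume {y : Fin m → ℝ | ‖y‖ < r ∧
              logAbs (inner ℝ (gradient f (x (y, E))) h₀) ≤
                ((5 * 10 ^ m * Real.log (ν₁ * ‖x₀‖) * H : ℝ) : EReal)} ≤
            ENNReal.ofReal (((ν₁ ^ 2)⁻¹ * r) ^ m *
              Real.exp (-(H ^ (1 / (((m + 1 : ℕ) : ℝ) - 1)))))) := by
  obtain ⟨b, g₀, hP⟩ := hM.exists_levelPatch hr₀' hr₀ hν₀' hν₁ hK hKν hx₀ hx₀'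
  rw [← hr] at hP
  obtain ⟨T, t, hTan, hTsol, htsol, htre, hT0⟩ := hP.exists_parametrization hM
  have hS := smallParams_of_lt hm hr₀ hr₀' hν₀ hν₀' hν₁ hK hKν hx₀ hx₀' hr
  have hrpos := hP.r_pos
  have hℓ := hS.patch_lt
  have hν₁' := hS.ν₁_le
  have hν₁1 : ν₁ ≤ 1 := by linarith
  have hp10 : ν₁ ^ 10 ≤ ν₁ ^ 6 := pow_le_pow_of_le_one hν₁.le hν₁1 (by norm_num)
  have hp6 : ν₁ ^ 6 ≤ ν₁ := pow_le_of_le_one hν₁.le hν₁1 (by norm_num)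
  have hXnear : ∀ q ∈ largeBox m r (f x₀),
      ‖complexFrame b x₀ q.1 (T q) - toComplexVec x₀‖ ≤ 14 * (m + 1) * r :=
    fun q hq => hP.norm_frame_sub_le hq.1 ((hTsol q hq).1.trans (by linarith))
  have hXnorm : ∀ q ∈ largeBox m r (f x₀), ‖complexFrame b x₀ q.1 (T q)‖ ≤ 2 * ‖x₀‖ := by
    intro q hq
    have h1 := norm_sub_norm_le (complexFrame b x₀ q.1 (T q)) (toComplexVec x₀)
    rw [norm_toComplexVec] at h1
    linarith [hXnear q hq]
  have hXan : AnalyticOnNhd ℂ (fun q => complexFrame b x₀ q.1 (T q)) (largeBox m r (f x₀)) :=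
    fun q hq => AnalyticAt.comp (f := fun q : (Fin m → ℂ) × ℂ => (q.1, T q))
      (contDiff_complexFrame b x₀).contDiffAt.analyticAt (analyticAt_fst.prod (hTan q hq))
  have hreal : ∀ (y : Fin m → ℝ) (E : ℝ), ‖y‖ < r → |E - f x₀| < r ^ 2 →
      complexFrame b x₀ (fun i => (y i : ℂ)) (T (fun i => (y i : ℂ), (E : ℂ))) =
        toComplexVec (realFrame b x₀ y (t (y, E))) := by
    intro y E hy hE
    rw [(htsol y E (by linarith) hE).1, complexFrame_ofReal]
  have hslice : ∀ E : ℝ, |E - f x₀| < r ^ 2 → ∀ w ∈ ball (0 : Fin m → ℂ) (13 * r),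
      (w, (E : ℂ)) ∈ largeBox m r (f x₀) := by
    intro E hE w hw
    refine ⟨mem_ball_zero_iff.1 hw, ?_⟩
    change ‖(E : ℂ) - (f x₀ : ℂ)‖ < r ^ 2
    rw [← Complex.ofReal_sub, Complex.norm_real]
    exact hE
  have hXdiff : ∀ E : ℝ, |E - f x₀| < r ^ 2 →
      AnalyticOnNhd ℂ (fun w => complexFrame b x₀ w (T (w, (E : ℂ)))) (ball 0 (13 * r)) :=
    fun E hE w hw => AnalyticAt.comp (f := fun w : Fin m → ℂ => (w, (E : ℂ)))
      (hXan _ (hslice E hE w hw)) (analyticAt_id.prod analyticAt_const)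
  have hroot : ∀ E : ℝ, |E - f x₀| < r ^ 2 → ∀ y : Fin m → ℝ, ‖y‖ < r →
      |t (y, E)| ≤ r ∧ f (realFrame b x₀ y (t (y, E))) = E := fun E hE y hy =>
    ⟨(htsol y E (by linarith) hE).2.1.trans (by linarith), (htsol y E (by linarith) hE).2.2⟩
  refine ⟨fun p => realFrame b x₀ p.1 (t p), ?_, fun p hp => (hroot p.2 hp.2 p.1 hp.1).2, ?_,
    ⟨fun q => complexFrame b x₀ q.1 (T q), hXan.mono (complexBox_subset_largeBox m hrpos _),
      fun p hp => hreal p.1 p.2 hp.1 hp.2, fun q hq =>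
        (hXnear q (complexBox_subset_largeBox m hrpos _ hq)).trans_lt hℓ⟩, ?_, ?_⟩
  · intro p hp
    have ht : AnalyticAt ℝ t p := by
      rw [funext htre]
      exact analyticOnNhd_re_ofReal hrpos (hTan.mono (complexBox_subset_largeBox m hrpos _)) p hp
    exact AnalyticAt.comp (f := fun q : (Fin m → ℝ) × ℝ => (q.1, t q))
      (contDiff_realFrame b x₀).contDiffAt.analyticAt (analyticAt_fst.prod ht)
  · have h1 : t (0, f x₀) = 0 := by
      rw [htre]
      change (T (fun _ => ((0 : ℝ) : ℂ), (f x₀ : ℂ))).re = 0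
      rw [Complex.ofReal_zero]
      exact (congrArg Complex.re hT0).trans Complex.zero_re
    simp [h1, realFrame]
  · intro E hE h hh hh' H hH
    have hhν : ‖h‖ ≤ ν₁ ^ 6 := by nlinarith [pow_pos hν₁ 10]
    have hhr : 4000 * ‖h‖ < r₀ := by nlinarith
    exact hP.volume_shift_le hS hM (W := fun w => complexFrame b x₀ w (T (w, (E : ℂ))))
      (t := fun y => t (y, E)) (hXdiff E hE) (fun w hw => hXnorm (w, (E : ℂ)) (hslice E hE w hw))
      (fun y hy => hreal y E hy hE) (hroot E hE) hE hh hhν hhr hH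
  · intro E hE h₀ hh₀ H hH
    exact hP.volume_derivative_le hS hM (W := fun w => complexFrame b x₀ w (T (w, (E : ℂ))))
      (t := fun y => t (y, E)) (hXdiff E hE) (fun w hw => hXnorm (w, (E : ℂ)) (hslice E hE w hw))
      (fun y hy => hreal y E hy hE) (hroot E hE) hh₀ hH

end Main

/-! ### Choice of constants and conclusion -/

theorem nuOne_eq_of_ne_zero {n : ℕ} {c ν₀ R : ℝ} {F : EuclideanSpace ℂ (Fin n) → ℂ}
    (h : nuOne c ν₀ F R ≠ 0) : derivSup F R 2 ≠ ⊤ ∧ derivSup F R 3 ≠ ⊤ ∧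
      nuOne c ν₀ F R = c * ν₀ / (1 + (derivSup F R 2).toReal + (derivSup F R 3).toReal) := by
  have h2 : derivSup F R 2 ≠ ⊤ := fun h2 => h (by simp [nuOne, h2])
  have h3 : derivSup F R 3 ≠ ⊤ := fun h3 => h (by simp [nuOne, h3])
  refine ⟨h2, h3, ?_⟩
  rw [nuOne, ENNReal.toReal_inv, ENNReal.toReal_add (ENNReal.add_ne_top.2 ⟨ENNReal.one_ne_top, h2⟩) h3,
    ENNReal.toReal_add ENNReal.one_ne_top h2, ENNReal.toReal_one, div_eq_mul_inv]

theorem mainTheorem6 (n : ℕ) (hn : 2 ≤ n) :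
    ∃ c₀ C Hmin : ℝ, 0 < c₀ ∧ 0 < C ∧ 0 < Hmin ∧
      ∀ c : ℝ, 0 < c → c ≤ c₀ →
      ∀ (r₀ ν₀ : ℝ), 0 < r₀ → r₀ < 1 → 0 < ν₀ → ν₀ < 1 →
      ∀ (f : EuclideanSpace ℝ (Fin n) → ℝ) (F : EuclideanSpace ℂ (Fin n) → ℂ),
        AnalyticOnNhd ℝ f (realCube n r₀) →
        AnalyticOnNhd ℂ F (polydisk n r₀) →
        (∀ x ∈ realCube n r₀, F (toComplexVec x) = (f x : ℂ)) →
        f 0 = 0 → gradient f 0 = 0 →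
        (hessian f 0 - ν₀ • (1 : Matrix (Fin n) (Fin n) ℝ)).PosSemidef →
      ∀ ν₁ ρ : ℝ, ν₁ = nuOne c ν₀ F r₀ → ρ = r₀ * ν₁ ^ 10 →
      ∀ x₀ : EuclideanSpace ℝ (Fin n), 0 < ‖x₀‖ → ‖x₀‖ < ρ →
      ∀ E₀ r : ℝ, E₀ = f x₀ → r = ν₁ * ‖x₀‖ →
      ∃ x : (Fin (n - 1) → ℝ) × ℝ → EuclideanSpace ℝ (Fin n),
        AnalyticOnNhd ℝ x (realBox (n - 1) r E₀) ∧
        (∀ p ∈ realBox (n - 1) r E₀, f (x p) = p.2) ∧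
        x (0, E₀) = x₀ ∧
        -- (I) analytic extension
        (∃ X : (Fin (n - 1) → ℂ) × ℂ → EuclideanSpace ℂ (Fin n),
          AnalyticOnNhd ℂ X (complexBox (n - 1) r E₀) ∧
          (∀ p ∈ realBox (n - 1) r E₀,
            X (fun i => (p.1 i : ℂ), (p.2 : ℂ)) = toComplexVec (x p)) ∧
          (∀ q ∈ complexBox (n - 1) r E₀, ‖X q - toComplexVec x₀‖ < ‖x₀‖ / 2)) ∧
        -- (II) estimate for shifts of the level set
        (∀ E : ℝ, |E - E₀| < r ^ 2 →
          ∀ h : EuclideanSpace ℝ (Fin n), 0 < ‖h‖ → ‖h‖ < ρ →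
          ∀ H : ℝ, Hmin ≤ H →
            MeasureTheory.volume {y : Fin (n - 1) → ℝ | ‖y‖ < r ∧
                logAbs (f (x (y, E) + h) - E) ≤
                  ((C * Real.log (‖h‖ * ‖x₀‖) * H : ℝ) : EReal)} ≤
              ENNReal.ofReal (((ν₁ ^ 2)⁻¹ * r) ^ (n - 1) *
                Real.exp (-(H ^ (1 / ((n : ℝ) - 1)))))) ∧
        -- (III) estimate for directional derivatives
        (∀ E : ℝ, |E - E₀| < r ^ 2 →
          ∀ h₀ : EuclideanSpace ℝ (Fin n), ‖h₀‖ = 1 →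
          ∀ H : ℝ, Hmin ≤ H →
            MeasureTheory.volume {y : Fin (n - 1) → ℝ | ‖y‖ < r ∧
                logAbs (inner ℝ (gradient f (x (y, E))) h₀) ≤
                  ((C * Real.log (ν₁ * ‖x₀‖) * H : ℝ) : EReal)} ≤
              ENNReal.ofReal (((ν₁ ^ 2)⁻¹ * r) ^ (n - 1) *
                Real.exp (-(H ^ (1 / ((n : ℝ) - 1)))))) := by
  obtain ⟨m, rfl⟩ : ∃ m, n = m + 1 := ⟨n - 1, by omega⟩
  have hm : 0 < m := by omega
  have hm0 : (0 : ℝ) ≤ m := m.cast_nonneg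
  -- The factor `(m + 1) ^ 3` cancels the `n ^ 3` in `K`; the rest is the smallness required of `K *
  -- ν₁`.
  refine ⟨1 / (4000 * (m + 1) ^ 2 * (m + 1) ^ 3), 5 * 10 ^ m, 1, by positivity, by positivity,
    one_pos, ?_⟩
  rintro c hc hc' r₀ ν₀ hr₀ hr₀' hν₀ hν₀' f F hf hF hfF hf0 hg0 hH ν₁ ρ hν₁ rfl x₀ hx₀ hx₀' E₀ r
    rfl hr
  -- A nonzero `x₀` inside the radius `ρ` forces `ν₁ ≠ 0`, and hence finite `M(2)` and `M(3)`.
  have hν₁ne : nuOne c ν₀ F r₀ ≠ 0 := by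
    intro h0
    rw [hν₁, h0, zero_pow (by norm_num), mul_zero] at hx₀'
    linarith
  obtain ⟨h2, h3, hν₁eq⟩ := nuOne_eq_of_ne_zero hν₁ne
  have hM2 : 0 ≤ (derivSup F r₀ 2).toReal := ENNReal.toReal_nonneg
  have hM3 : 0 ≤ (derivSup F r₀ 3).toReal := ENNReal.toReal_nonneg
  set S := 1 + (derivSup F r₀ 2).toReal + (derivSup F r₀ 3).toReal with hS
  have hS1 : 1 ≤ S := by linarith
  have hS0 : 0 < S := by linarith
  rw [← hν₁] at hν₁eq
  have hν₁pos : 0 < ν₁ := by rw [hν₁eq]; positivity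
  have hM := nondegMin_of_derivSup (K := ((m + 1 : ℕ) : ℝ) ^ 3 * S) (Nat.le_add_left 1 m) hr₀ hf hF
    hfF hf0 hg0 hH h2 h3 rfl
  rw [Nat.cast_add, Nat.cast_one] at hM
  have hcube : (1 : ℝ) ≤ (m + 1) ^ 3 := one_le_pow₀ (by linarith)
  refine hM.exists_level_parametrization hm hr₀ hr₀' hν₀ hν₀' hν₁pos (by nlinarith) ?_ hx₀ hx₀' hr
  have h4 : ((m : ℝ) + 1) ^ 3 * S * ν₁ = (m + 1) ^ 3 * c * ν₀ := by
    rw [hν₁eq]; field_simp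
  rw [le_div_iff₀ (by positivity)] at hc'
  rw [h4]
  calc 4000 * ((m : ℝ) + 1) ^ 2 * ((m + 1) ^ 3 * c * ν₀)
      = c * (4000 * (m + 1) ^ 2 * (m + 1) ^ 3) * ν₀ := by ring
    _ ≤ 1 * ν₀ := by gcongr
    _ = ν₀ := one_mul _
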